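/- Let $d\ge 1$. For $N\in\mathbb N$ let $\mathbb T^d_N=(\mathbb Z/N\mathbb Z)^d$, with graph distance $|x-y|$ for the nearest-neighbour graph, and let $\mathcal P(\mathbb T^d_N)$ be the set of probability mass functions on $\mathbb T^d_N$. For $\eta\in\mathcal P(\mathbb T^d_N)$ and $|x-y|=1$ let $\eta^{xy}$ be obtained from $\eta$ by replacing both $\eta(x)$ and $\eta(y)$ by $\tfrac12(\eta(x)+\eta(y))$. The averaging process is the Markov jump process on $\mathcal P(\mathbb T^d_N)$ with generator $$\mathcal L f(\eta)=\frac12\sum_{x\in\mathbb T^d_N}\ \sum_{y:\,|x-y|=1}\big(f(\eta^{xy})-f(\eta)\big),\qquad f\in\mathcal C(\mathcal P(\mathbb T^d_N));$$ write $\eta_t(0,\cdot)$ for this process at time $t$ when it is started from the unit mass at $0\in\mathbb T^d_N$, and $\mathbb E$ for the expectation. Let $t_{\rm rel}=1/\lambda$, where $\lambda$ is the spectral gap, i.e. the smallest non-zero eigenvalue of $-L$ with $L\psi(x)=\frac12\sum_{y:\,|x-y|=1}(\psi(y)-\psi(x))$, $\psi\in\mathbb R^{\mathbb T^d_N}$.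 **Proposition (pointwise gradient estimates).** For every $d\ge1$ there are constants $B,C>0$, depending only on $d$, such that for all $N$ large enough (depending only on $d$), all $t\ge 0$, and all $x,y\in\mathbb T^d_N$ with $|x-y|=1$, $$\mathbb E\Big[\big(\eta_t(0,x)-\eta_t(0,y)\big)^2\Big]\le \frac{C}{(N^{2d+2}\wedge t^{d+1})\vee 1}\,\exp\Big(-\frac{2t}{t_{\rm rel}}+\frac{Bt}{N^{d+2}}\Big).$$ -/

import Mathlib

open MeasureTheory Filter Topology
open scoped NNReal

noncomputable section

namespace AvgTorus

/-- The discrete `d`-dimensional torus `(ℤ/Nℤ)^d`. -/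
abbrev Torus (d N : ℕ) : Type := Fin d → ZMod N

/-- The nearest-neighbour graph of the torus: distinct `x, y` are adjacent when they differ by
`± 1` in one coordinate; this is the relation `|x - y| = 1` for the graph distance. -/
def torusGraph (d N : ℕ) : SimpleGraph (Torus d N) :=
  SimpleGraph.fromRel fun x y => ∃ i : Fin d, y = x + Pi.single i 1

/-- The probability mass functions on the torus, with the topology and the Borel σ-algebra
inherited from `ℝ^(Torus d N)`. -/
abbrev Prob (d N : ℕ) [NeZero N] : Type := stdSimplex ℝ (Torus d N)

section Averaging

variable {d N : ℕ} [NeZero N]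

open Classical in
/-- The function `η^{xy}`: the masses at `x` and `y` are both replaced by their average. -/
def avgFun (x y : Torus d N) (η : Torus d N → ℝ) : Torus d N → ℝ := fun z =>
  if z = x ∨ z = y then (η x + η y) / 2 else η z

lemma avgFun_mem {x y : Torus d N} (hxy : x ≠ y) {η : Torus d N → ℝ}
    (h : η ∈ stdSimplex ℝ (Torus d N)) : avgFun x y η ∈ stdSimplex ℝ (Torus d N) := by
  classical
  refine ⟨fun z => ?_, ?_⟩
  · have h1 := h.1 x
    have h2 := h.1 y
    have h3 := h.1 z
    unfold avgFun
    split_ifs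
    · linarith
    · exact h3
  · rw [← h.2]
    have hpt : ∀ z, avgFun x y η z = η z + ((if z = x then (η y - η x) / 2 else 0)
        + (if z = y then (η x - η y) / 2 else 0)) := by
      intro z
      unfold avgFun
      by_cases hzx : z = x
      · subst hzx
        simp [hxy]
        ring
      · by_cases hzy : z = y
        · subst hzy
          simp [hzx]
          ring
        · simp [hzx, hzy]
    simp only [hpt, Finset.sum_add_distrib, Finset.sum_ite_eq', Finset.mem_univ, if_true]
    ring

lemma continuous_avgFun (x y : Torus d N) : Continuous (avgFun x y) := by
  classical
  refine continuous_pi fun z => ?_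
  unfold avgFun
  split_ifs <;> fun_prop

/-- The update `η ↦ η^{xy}` along an edge, as a continuous self-map of the space of probability
mass functions. -/
def avgUpdate {x y : Torus d N} (h : (torusGraph d N).Adj x y) : C(Prob d N, Prob d N) where
  toFun η := ⟨avgFun x y η.1, avgFun_mem h.ne η.2⟩
  continuous_toFun := ((continuous_avgFun x y).comp continuous_subtype_val).subtype_mk _

/-- Composition `f ↦ f ∘ φ` as a bounded operator on continuous functions. -/
def compOp (φ : C(Prob d N, Prob d N)) : C(Prob d N, ℝ) →L[ℝ] C(Prob d N, ℝ) where
  toLinearMap := (ContinuousMap.compRightAlgHom ℝ ℝ φ).toLinearMap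
  cont := ContinuousMap.compRightAlgHom_continuous (R := ℝ) (A := ℝ) φ

variable (d N)

open Classical in
/-- The generator of the averaging process:
`𝓛 f (η) = 1/2 ∑_x ∑_{y : |x - y| = 1} (f (η^{xy}) - f η)`, a bounded operator on the continuous
functions on the space of probability mass functions. -/
def generator : C(Prob d N, ℝ) →L[ℝ] C(Prob d N, ℝ) :=
  (1 / 2 : ℝ) • ∑ x : Torus d N, ∑ y : Torus d N,
    if h : (torusGraph d N).Adj x y then compOp (avgUpdate h) - ContinuousLinearMap.id ℝ _ else 0

open Classical in
lemma generator_apply (f : C(Prob d N, ℝ)) (η : Prob d N) :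
    generator d N f η = (1 / 2 : ℝ) * ∑ x : Torus d N, ∑ y : Torus d N,
      if h : (torusGraph d N).Adj x y then f (avgUpdate h η) - f η else 0 := by
  simp only [generator, smul_apply, sum_apply,
    ContinuousMap.smul_apply, ContinuousMap.sum_apply, smul_eq_mul]
  congr 1
  refine Finset.sum_congr rfl fun x _ => Finset.sum_congr rfl fun y _ => ?_
  split_ifs <;> rfl

/-- The exponential `e^A = ∑ A^n / n!` of a bounded operator. -/
def opExp {E : Type*} [NormedAddCommGroup E] [NormedSpace ℝ E] (A : E →L[ℝ] E) : E →L[ℝ] E :=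
  NormedSpace.exp A

/-- The Markov semigroup `e^{t𝓛}` generated by `𝓛`. -/
def semigroup (t : ℝ≥0) : C(Prob d N, ℝ) →L[ℝ] C(Prob d N, ℝ) :=
  opExp ((t : ℝ) • generator d N)

variable {d N}

/-- The history up to time `s` of a process, `σ(η_r : r ≤ s)`. -/
abbrev history {Ω : Type*} (η : ℝ≥0 → Ω → Prob d N) (s : ℝ≥0) : MeasurableSpace Ω :=
  ⨆ r : Set.Iic s, MeasurableSpace.comap (η r) inferInstance

/-- `η` is, under `P`, a version of the averaging process started from `ξ`: the Markov jump process
on the space of probability mass functions with infinitesimal generator `generator d N`. -/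
structure IsAveragingProcess {Ω : Type*} [MeasurableSpace Ω] (P : Measure Ω) (ξ : Prob d N)
    (η : ℝ≥0 → Ω → Prob d N) : Prop where
  measurable : ∀ t, Measurable (η t)
  initial : ∀ᵐ ω ∂P, η 0 ω = ξ
  /-- The trajectories are right-continuous step functions, with finitely many jumps in each
  bounded time interval. -/
  jump : ∀ᵐ ω ∂P, ∀ t, (∀ᶠ s in 𝓝[>] t, η s ω = η t ω) ∧ ∃ ζ, ∀ᶠ s in 𝓝[<] t, η s ω = ζ
  /-- The Markov property: given the history up to time `s`, the law of `η_{s+t}` is given by the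
  semigroup at time `t` evaluated at the current state. -/
  markov : ∀ (s t : ℝ≥0) (f : C(Prob d N, ℝ)),
    P[fun ω => f (η (s + t) ω) | history η s] =ᵐ[P] fun ω => semigroup d N t f (η s ω)

end Averaging

section RandomWalk

variable (d N : ℕ) [NeZero N]

open Classical in
/-- The generator of the lazy random walk on the torus,
`L ψ (x) = 1/2 ∑_{y : |x - y| = 1} (ψ y - ψ x)`. -/
def rwGenerator : Module.End ℝ (Torus d N → ℝ) where
  toFun ψ x := (1 / 2 : ℝ) * ∑ y : Torus d N, if (torusGraph d N).Adj x y then ψ y - ψ x else 0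
  map_add' ψ φ := by
    funext x
    simp only [Pi.add_apply, ← mul_add, ← Finset.sum_add_distrib]
    congr 1
    refine Finset.sum_congr rfl fun y _ => ?_
    split_ifs <;> ring
  map_smul' c ψ := by
    funext x
    simp only [Pi.smul_apply, smul_eq_mul, RingHom.id_apply, Finset.mul_sum]
    refine Finset.sum_congr rfl fun y _ => ?_
    split_ifs <;> ring

/-- The spectral gap: the smallest non-zero eigenvalue of `-L`. -/
def spectralGap : ℝ :=
  sInf {μ : ℝ | μ ≠ 0 ∧ Module.End.HasEigenvalue (-rwGenerator d N) μ}

/-- The relaxation time, the inverse of the spectral gap. -/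
def relaxationTime : ℝ := 1 / spectralGap d N

end RandomWalk

end AvgTorus

end

noncomputable section

namespace AvgTorus

/-! ### The heat kernel of the discrete circle -/

section Circle

/-! The proof closes a renewal equation for the mean squared increments `meanSqGrad t e`. Testing
the state against a function and squaring, the generator produces twice the square's heat-flow drift
plus one quarter of the sum over edges of (increment of the test function)² times (increment of the
state)² (`generator_pairing_sq`). Letting the test function run backwards along the heat flow from
an edge `f` cancels the drift, and Duhamel's formula gives `meanSqGrad_eq`. Its source is the
squared gradient of the heat kernel, and its kernel is one quarter of the squared mixed second
difference.

The energy identity makes this kernel subcritical. The signed unit masses at the ends of an edge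
have squared ℓ² norm 2, and the heat flow dissipates at most that much, so the kernel has mass at
most 1/2. Weighting time by `exp (tiltRate * r)`, with a rate just below twice the gap, costs only
O(1/N). The mass then stays at most 5/8 for large `N` (`integral_kernel_le`), and the source keeps
bounded mass (`integral_source_le`).

The pointwise estimate is `renewal_bound`, with weight `diffScale ^ (2 * (d + 1))`. At the maximum
of weight times solution, the convolution is split in time. Long lags are controlled by kernel decay
and the total mass of the solution. Short lags are absorbed, because there the weight changes by a
factor at most 6/5 and 6/5 * 5/8 = 3/4 < 1.

The analytic input consists of bounds for the heat kernel and its first and second differences, with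
the exponential rate of the gap (`exists_torusKernel_bounds`). They come from Fourier sums on the
circle and the product structure of the torus kernel. -/

lemma abs_spectral_le {N : ℕ} {f F : ZMod N → ℝ} (s : Finset (ZMod N)) (h : ∀ k ∈ s, |f k| ≤ F k) :
    |(1 / N : ℝ) * ∑ k ∈ s, f k| ≤ (1 / N : ℝ) * ∑ k ∈ s, F k := by
  rw [abs_mul, abs_of_nonneg (by positivity : (0 : ℝ) ≤ 1 / N)]
  exact mul_le_mul_of_nonneg_left ((Finset.abs_sum_le_sum_abs _ _).trans (Finset.sum_le_sum h))
    (by positivity)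

variable {N : ℕ} [NeZero N]

/-- The real part of the standard additive character of `ℤ/Nℤ`. -/
def charRe (x : ZMod N) : ℝ := (ZMod.stdAddChar x : ℂ).re

/-- The imaginary part of the standard additive character of `ℤ/Nℤ`. -/
def charIm (x : ZMod N) : ℝ := (ZMod.stdAddChar x : ℂ).im

lemma charRe_zero : charRe (0 : ZMod N) = 1 := by simp [charRe]

lemma charRe_sq_add_charIm_sq (x : ZMod N) : charRe x ^ 2 + charIm x ^ 2 = 1 := by
  have h : Complex.normSq (ZMod.stdAddChar x : ℂ) = 1 := by
    rw [ZMod.stdAddChar_apply, Complex.normSq_eq_norm_sq, Circle.norm_coe, one_pow]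
  rw [Complex.normSq_apply] at h
  simp only [charRe, charIm, pow_two, h]

lemma charRe_add (a b : ZMod N) :
    charRe (a + b) = charRe a * charRe b - charIm a * charIm b := by
  simp [charRe, charIm, AddChar.map_add_eq_mul]

lemma charIm_add (a b : ZMod N) :
    charIm (a + b) = charRe a * charIm b + charIm a * charRe b := by
  simp [charRe, charIm, AddChar.map_add_eq_mul]

lemma charIm_zero : charIm (0 : ZMod N) = 0 := by simp [charIm]

lemma charRe_neg (x : ZMod N) : charRe (-x) = charRe x := by
  have h1 := charRe_add x (-x)
  have h2 := charIm_add x (-x)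
  have h3 := charRe_sq_add_charIm_sq x
  rw [add_neg_cancel, charRe_zero] at h1
  rw [add_neg_cancel, charIm_zero] at h2
  linear_combination (-charRe x) * h1 - charIm x * h2 - charRe (-x) * h3

lemma charIm_neg (x : ZMod N) : charIm (-x) = -charIm x := by
  have h1 := charRe_add x (-x)
  have h2 := charIm_add x (-x)
  have h3 := charRe_sq_add_charIm_sq x
  rw [add_neg_cancel, charRe_zero] at h1
  rw [add_neg_cancel, charIm_zero] at h2
  linear_combination (charIm x) * h1 - charRe x * h2 - charIm (-x) * h3

lemma charRe_add_add_charRe_sub (a b : ZMod N) :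
    charRe (a + b) + charRe (a - b) = 2 * charRe a * charRe b := by
  rw [sub_eq_add_neg, charRe_add, charRe_add, charRe_neg, charIm_neg]
  ring

lemma abs_charRe_le_one (x : ZMod N) : |charRe x| ≤ 1 := by
  have h := charRe_sq_add_charIm_sq x
  exact abs_le_one_iff_mul_self_le_one.2 (by nlinarith [sq_nonneg (charIm x)])

/-- The difference is the real part of χ(a)(χ(b) - 1), and |χ(b) - 1|² = 2(1 - Re χ(b)). The squared
imaginary part is what gets dropped. -/
lemma sq_charRe_add_sub_le (a b : ZMod N) :
    (charRe (a + b) - charRe a) ^ 2 ≤ 2 * (1 - charRe b) := by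
  rw [charRe_add]
  have ha := charRe_sq_add_charIm_sq a
  have hb := charRe_sq_add_charIm_sq b
  have h : (charRe a * charRe b - charIm a * charIm b - charRe a) ^ 2
      + (charRe a * charIm b + charIm a * (charRe b - 1)) ^ 2 = 2 * (1 - charRe b) := by
    linear_combination ((charRe b - 1) ^ 2 + charIm b ^ 2) * ha + hb
  nlinarith [sq_nonneg (charRe a * charIm b + charIm a * (charRe b - 1))]

lemma sum_charRe_mul (j : ZMod N) :
    ∑ k : ZMod N, charRe (k * j) = if j = 0 then (N : ℝ) else 0 := by
  have h := AddChar.sum_mulShift j (ZMod.isPrimitive_stdAddChar N)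
  have h2 := congrArg Complex.re h
  rw [Complex.re_sum] at h2
  simp only [charRe]
  rw [h2]
  split_ifs <;> simp [ZMod.card]

lemma charRe_eq_cos (k : ZMod N) : charRe k = Real.cos (2 * Real.pi * k.val / N) := by
  have h : ((k.val : ℤ) : ZMod N) = k := by simp
  have h2 := ZMod.toCircle_intCast (N := N) (k.val : ℤ)
  rw [h] at h2
  rw [charRe, ZMod.stdAddChar_apply, h2]
  have : (2 * (Real.pi : ℂ) * Complex.I * ((k.val : ℤ) : ℂ) / (N : ℂ))
      = ((2 * Real.pi * k.val / N : ℝ) : ℂ) * Complex.I := by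
    push_cast
    ring
  rw [this, Complex.exp_ofReal_mul_I_re]

/-- `sin (π k / N)`, for `k` in `ℤ/Nℤ` represented in `[0, N)`. -/
def halfSin (k : ZMod N) : ℝ := Real.sin (Real.pi * k.val / N)

lemma one_sub_charRe (k : ZMod N) : 1 - charRe k = 2 * halfSin k ^ 2 := by
  rw [charRe_eq_cos, halfSin, show 2 * Real.pi * k.val / N = 2 * (Real.pi * k.val / N) by ring,
    Real.cos_two_mul, Real.sin_sq]
  ring

lemma halfSin_nonneg (k : ZMod N) : 0 ≤ halfSin k := by
  have hN : (0 : ℝ) < N := Nat.cast_pos.2 (NeZero.pos N)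
  refine Real.sin_nonneg_of_nonneg_of_le_pi (by positivity) ?_
  rw [div_le_iff₀ hN]
  exact mul_le_mul_of_nonneg_left (Nat.cast_le.2 (ZMod.val_lt k).le) Real.pi_pos.le

lemma abs_charRe_add_sub_le (a b : ZMod N) : |charRe (a + b) - charRe a| ≤ 2 * halfSin b := by
  refine abs_le_of_sq_le_sq ?_ (by linarith [halfSin_nonneg b])
  have := sq_charRe_add_sub_le a b
  rw [one_sub_charRe] at this
  linarith

variable (N) in
/-- The spectral gap of the circle, `1 - cos (2π/N) = 2 sin² (π/N)`. -/
def circleGap : ℝ := 2 * Real.sin (Real.pi / N) ^ 2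

/-- The length scale `1 ∨ (N ∧ √t)` of the walk at time `t`. -/
def diffScale (N : ℕ) (t : ℝ) : ℝ := max 1 (min (N : ℝ) (Real.sqrt t))

lemma one_le_diffScale (N : ℕ) (t : ℝ) : 1 ≤ diffScale N t := le_max_left _ _

lemma diffScale_pos (N : ℕ) (t : ℝ) : 0 < diffScale N t := one_pos.trans_le (one_le_diffScale N t)

/-! ### Weighted spectral sums on the circle -/

lemma sum_exp_neg_mul_le {b : ℝ} (hb : 0 < b) (n : ℕ) :
    ∑ k ∈ Finset.Ico 1 n, Real.exp (-(b * k)) ≤ 1 / b := by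
  have hx0 : 0 < Real.exp (-b) := Real.exp_pos _
  have hx1 : Real.exp (-b) < 1 := by rw [Real.exp_lt_one_iff]; linarith
  have hterm : ∀ k : ℕ, Real.exp (-(b * k)) = Real.exp (-b) ^ k := fun k => by
    rw [← Real.exp_nat_mul]; ring_nf
  have hsum : ∀ n : ℕ, ∑ k ∈ Finset.Ico 1 n, Real.exp (-b) ^ k
      ≤ Real.exp (-b) / (1 - Real.exp (-b)) := by
    intro n
    rw [le_div_iff₀ (by linarith)]
    rcases Nat.eq_zero_or_pos n with rfl | hn
    · simp [hx0.le]
    · have h := geom_sum_Ico_mul_neg (Real.exp (-b)) hn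
      rw [h, pow_one]
      linarith [pow_pos hx0 n]
  simp only [hterm]
  refine (hsum n).trans ?_
  rw [div_le_div_iff₀ (by linarith) hb]
  have h1 : b + 1 ≤ Real.exp b := Real.add_one_le_exp b
  have h2 : Real.exp (-b) * Real.exp b = 1 := by rw [← Real.exp_add]; simp
  nlinarith

/-- Trades Gaussian decay for geometric decay, which can be summed explicitly: x ^ j ≤ j! e ^ x, and
2x - x² ≤ 1. -/
lemma pow_mul_exp_neg_sq_le (j : ℕ) {x : ℝ} (hx : 0 ≤ x) :
    x ^ j * Real.exp (-x ^ 2) ≤ j.factorial * Real.exp 1 * Real.exp (-x) := by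
  have h1 : x ^ j ≤ j.factorial * Real.exp x := by
    have := Real.pow_div_factorial_le_exp x hx j
    rwa [div_le_iff₀ (by positivity), mul_comm] at this
  have h2 : Real.exp x * Real.exp (-x ^ 2) ≤ Real.exp 1 * Real.exp (-x) := by
    rw [← Real.exp_add, ← Real.exp_add, Real.exp_le_exp]
    nlinarith [sq_nonneg (x - 1)]
  calc x ^ j * Real.exp (-x ^ 2) ≤ j.factorial * Real.exp x * Real.exp (-x ^ 2) := by gcongr
    _ = j.factorial * (Real.exp x * Real.exp (-x ^ 2)) := by ring
    _ ≤ j.factorial * (Real.exp 1 * Real.exp (-x)) := by gcongr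
    _ = _ := by ring

lemma two_mul_le_sin_pi_mul {n k : ℕ} (hn : 0 < n) (hk : 2 * k ≤ n) :
    2 * (k : ℝ) / n ≤ Real.sin (Real.pi * k / n) := by
  have hn' : (0 : ℝ) < n := Nat.cast_pos.2 hn
  have hk' : 2 * (k : ℝ) ≤ n := by exact_mod_cast hk
  have h := Real.mul_le_sin (x := Real.pi * k / n) (by positivity) (by
    rw [div_le_div_iff₀ hn' two_pos]; nlinarith [Real.pi_pos])
  refine le_trans (le_of_eq ?_) h
  field_simp

lemma sin_pi_mul_sub {n k : ℕ} (hn : 0 < n) (hk : k ≤ n) :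
    Real.sin (Real.pi * (n - k : ℕ) / n) = Real.sin (Real.pi * k / n) := by
  have hn' : (n : ℝ) ≠ 0 := (Nat.cast_pos.2 hn).ne'
  rw [Nat.cast_sub hk, ← Real.sin_pi_sub]
  congr 1
  field_simp
  ring

/-- By monotonicity the worst case is k = 2, where sin 2θ = 2 sin θ cos θ ≥ √2 sin θ since θ = π/n ≤
π/4. So every frequency other than ±1 has at least twice the gap, and half of its decay survives
once the factor exp(-gap * t) is taken out. -/
lemma two_mul_sq_sin_le_of_le_half {n k : ℕ} (hn : 4 ≤ n) (hk2 : 2 ≤ k) (hk : 2 * k ≤ n) :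
    2 * Real.sin (Real.pi / n) ^ 2 ≤ Real.sin (Real.pi * k / n) ^ 2 := by
  have hn' : (4 : ℝ) ≤ n := by exact_mod_cast hn
  have hk' : 2 * (k : ℝ) ≤ n := by exact_mod_cast hk
  have hk2' : (2 : ℝ) ≤ k := by exact_mod_cast hk2
  have hpi := Real.pi_pos
  have hmono : Real.sin (2 * (Real.pi / n)) ≤ Real.sin (Real.pi * k / n) := by
    apply Real.sin_le_sin_of_le_of_le_pi_div_two
    · have : 0 ≤ 2 * (Real.pi / n) := by positivity
      linarith
    · rw [div_le_div_iff₀ (by linarith) two_pos]; nlinarith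
    · rw [← mul_div_assoc, div_le_div_iff_of_pos_right (by linarith)]; nlinarith
  have hs : 0 ≤ Real.sin (Real.pi / n) := Real.sin_nonneg_of_nonneg_of_le_pi (by positivity) (by
    rw [div_le_iff₀ (by linarith)]; nlinarith)
  have hc : Real.sqrt 2 / 2 ≤ Real.cos (Real.pi / n) := by
    rw [← Real.cos_pi_div_four]
    apply Real.cos_le_cos_of_nonneg_of_le_pi (by positivity) (by linarith)
    exact div_le_div_of_nonneg_left hpi.le (by norm_num) hn'
  rw [Real.sin_two_mul] at hmono
  have h3 : Real.sqrt 2 * Real.sin (Real.pi / n) ≤ Real.sin (Real.pi * k / n) := by nlinarith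
  have h4 := pow_le_pow_left₀ (by positivity) h3 2
  rw [mul_pow, Real.sq_sqrt (by norm_num)] at h4
  exact h4

lemma two_mul_sq_sin_le {n k : ℕ} (hn : 4 ≤ n) (hk2 : 2 ≤ k) (hk : k + 2 ≤ n) :
    2 * Real.sin (Real.pi / n) ^ 2 ≤ Real.sin (Real.pi * k / n) ^ 2 := by
  rcases le_total (2 * k) n with h | h
  · exact two_mul_sq_sin_le_of_le_half hn hk2 h
  · rw [← sin_pi_mul_sub (by omega) (by omega : k ≤ n)]
    exact two_mul_sq_sin_le_of_le_half hn (by omega) (by omega)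

lemma sin_pi_div_le (n : ℕ) : Real.sin (Real.pi / n) ≤ 4 / n := by
  refine (Real.sin_le (by positivity)).trans ?_
  gcongr
  exact Real.pi_le_four

lemma sin_pi_div_nonneg (n : ℕ) : 0 ≤ Real.sin (Real.pi / n) := by
  rcases Nat.eq_zero_or_pos n with rfl | hn
  · simp
  · exact Real.sin_nonneg_of_nonneg_of_le_pi (by positivity)
      (div_le_self Real.pi_pos.le (by exact_mod_cast hn))

lemma exp_neg_mul_sin_le {n k : ℕ} (hn : 0 < n) (hk : k ≤ n) {τ : ℝ} (hτ : 0 ≤ τ) :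
    Real.exp (-(τ * Real.sin (Real.pi * k / n)))
      ≤ Real.exp (-(2 * τ / n * k)) + Real.exp (-(2 * τ / n * (n - k : ℕ))) := by
  have key : ∀ l : ℕ, 2 * l ≤ n →
      Real.exp (-(τ * Real.sin (Real.pi * l / n))) ≤ Real.exp (-(2 * τ / n * l)) := by
    intro l hl
    rw [Real.exp_le_exp, neg_le_neg_iff]
    calc 2 * τ / n * l = τ * (2 * l / n) := by ring
      _ ≤ _ := mul_le_mul_of_nonneg_left (two_mul_le_sin_pi_mul hn hl) hτ
  rcases le_total (2 * k) n with h | h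
  · exact (key k h).trans (le_add_of_nonneg_right (Real.exp_pos _).le)
  · have := key (n - k) (by omega)
    rw [sin_pi_mul_sub hn hk] at this
    exact this.trans (le_add_of_nonneg_left (Real.exp_pos _).le)

/-- The frequencies ±1 have zero exponent after the gap is removed and contribute only their
prefactor. For the others the exponent is at most -t sin², which is turned into geometric decay in
the distance of `k` to either end. -/
lemma spectral_term_le (j : ℕ) {n k : ℕ} (hn : 4 ≤ n) (hk : k ∈ Finset.Ico 1 n) {t : ℝ}
    (ht : 0 < t) :
    Real.sin (Real.pi * k / n) ^ j
        * Real.exp (-t * (2 * Real.sin (Real.pi * k / n) ^ 2 - 2 * Real.sin (Real.pi / n) ^ 2))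
      ≤ ((if k = 1 then (4 / n : ℝ) ^ j else 0) + if k = n - 1 then (4 / n : ℝ) ^ j else 0)
        + j.factorial * Real.exp 1 / Real.sqrt t ^ j
          * (Real.exp (-(2 * Real.sqrt t / n * k))
            + Real.exp (-(2 * Real.sqrt t / n * (n - k : ℕ)))) := by
  obtain ⟨hk1, hkn⟩ := Finset.mem_Ico.1 hk
  have hlast : 0 ≤ j.factorial * Real.exp 1 / Real.sqrt t ^ j
          * (Real.exp (-(2 * Real.sqrt t / n * k))
            + Real.exp (-(2 * Real.sqrt t / n * (n - k : ℕ)))) := by positivity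
  have hfour : (0 : ℝ) ≤ (4 / n : ℝ) ^ j := by positivity
  have hend : Real.sin (Real.pi * k / n) = Real.sin (Real.pi / n) →
      Real.sin (Real.pi * k / n) ^ j
        * Real.exp (-t * (2 * Real.sin (Real.pi * k / n) ^ 2 - 2 * Real.sin (Real.pi / n) ^ 2))
      ≤ (4 / n : ℝ) ^ j := by
    intro h
    rw [h, sub_self, mul_zero, Real.exp_zero, mul_one]
    exact pow_le_pow_left₀ (sin_pi_div_nonneg n) (sin_pi_div_le n) j
  by_cases h1 : k = 1
  · have := hend (by rw [h1]; simp)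
    rw [if_pos h1]
    have : 0 ≤ (if k = n - 1 then (4 / n : ℝ) ^ j else 0) := by split_ifs <;> simp [hfour]
    linarith
  by_cases h2 : k = n - 1
  · have := hend (by
      rw [← sin_pi_mul_sub (by omega) hkn.le, show n - k = 1 by omega]; simp)
    rw [if_pos h2, if_neg h1]
    linarith
  rw [if_neg h1, if_neg h2, add_zero, zero_add]
  have hs := two_mul_sq_sin_le hn (by omega : 2 ≤ k) (by omega)
  have hn0 : (0 : ℝ) < n := by exact_mod_cast (by omega : 0 < n)
  set s := Real.sin (Real.pi * k / n) with hsdef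
  have hs0 : 0 ≤ s := Real.sin_nonneg_of_nonneg_of_le_pi (by positivity) (by
    rw [div_le_iff₀ hn0]; gcongr)
  have hτ : 0 < Real.sqrt t := Real.sqrt_pos.2 ht
  have hτ2 : Real.sqrt t ^ 2 = t := Real.sq_sqrt ht.le
  calc s ^ j * Real.exp (-t * (2 * s ^ 2 - 2 * Real.sin (Real.pi / n) ^ 2))
      ≤ s ^ j * Real.exp (-(Real.sqrt t * s) ^ 2) := by
        gcongr
        rw [mul_pow, hτ2]
        nlinarith
    _ = (Real.sqrt t * s) ^ j * Real.exp (-(Real.sqrt t * s) ^ 2) / Real.sqrt t ^ j := by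
        rw [mul_pow (Real.sqrt t) s j]; field_simp
    _ ≤ j.factorial * Real.exp 1 * Real.exp (-(Real.sqrt t * s)) / Real.sqrt t ^ j := by
        exact div_le_div_of_nonneg_right (pow_mul_exp_neg_sq_le j (by positivity)) (by positivity)
    _ = j.factorial * Real.exp 1 / Real.sqrt t ^ j * Real.exp (-(Real.sqrt t * s)) := by ring
    _ ≤ _ := by
        gcongr
        exact exp_neg_mul_sin_le (by omega) hkn.le hτ.le

/-- The two lowest frequencies give the power of `n`. The geometric series has sum of order n/√t,
and the normalization 1/n turns this into one further power of 1/√t. -/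
lemma sum_spectral_term_le (j : ℕ) {n : ℕ} (hn : 4 ≤ n) {t : ℝ} (ht : 0 < t) :
    (1 / n : ℝ) * ∑ k ∈ Finset.Ico 1 n, Real.sin (Real.pi * k / n) ^ j
        * Real.exp (-t * (2 * Real.sin (Real.pi * k / n) ^ 2 - 2 * Real.sin (Real.pi / n) ^ 2))
      ≤ 2 * 4 ^ j / n ^ (j + 1) + j.factorial * Real.exp 1 / Real.sqrt t ^ (j + 1) := by
  have hn0 : (0 : ℝ) < n := by exact_mod_cast (by omega : 0 < n)
  have hτ : 0 < Real.sqrt t := Real.sqrt_pos.2 ht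
  have hb : 0 < 2 * Real.sqrt t / n := by positivity
  have hrefl : ∑ k ∈ Finset.Ico 1 n, Real.exp (-(2 * Real.sqrt t / n * (n - k : ℕ)))
      = ∑ k ∈ Finset.Ico 1 n, Real.exp (-(2 * Real.sqrt t / n * k)) := by
    refine Finset.sum_nbij' (fun k => n - k) (fun k => n - k) ?_ ?_ ?_ ?_ ?_ <;>
      intro k hk <;> simp only [Finset.mem_Ico] at hk ⊢ <;> omega
  have hgeo := sum_exp_neg_mul_le hb n
  have h := Finset.sum_le_sum fun k hk => spectral_term_le j hn (k := k) hk ht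
  rw [Finset.sum_add_distrib, Finset.sum_add_distrib, ← Finset.mul_sum, Finset.sum_add_distrib,
    hrefl, Finset.sum_ite_eq', Finset.sum_ite_eq', if_pos (Finset.mem_Ico.2 ⟨le_rfl, by omega⟩),
    if_pos (Finset.mem_Ico.2 ⟨by omega, by omega⟩)] at h
  calc _ ≤ (1 / n : ℝ) * ((4 / n) ^ j + (4 / n) ^ j + j.factorial * Real.exp 1 / Real.sqrt t ^ j
          * (1 / (2 * Real.sqrt t / n) + 1 / (2 * Real.sqrt t / n))) := by
        refine mul_le_mul_of_nonneg_left (h.trans ?_) (by positivity)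
        gcongr
    _ = _ := by
        rw [div_pow]; field_simp; ring

lemma le_div_diffScale {N : ℕ} (hN : 1 ≤ N) {X a b c : ℝ} (ha : 0 ≤ a) (hb : 0 ≤ b) (hc : 0 ≤ c)
    {t : ℝ} (n : ℕ) (hsmall : t ≤ 1 → X ≤ a)
    (hlarge : 1 ≤ t → X ≤ b / N ^ n + c / Real.sqrt t ^ n) :
    X ≤ (a + b + c) / diffScale N t ^ n := by
  have hN' : (1 : ℝ) ≤ N := by exact_mod_cast hN
  rcases le_total t 1 with ht | ht
  · have : diffScale N t = 1 := by
      refine max_eq_left ((min_le_right _ _).trans ?_)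
      exact Real.sqrt_le_one.2 ht
    rw [this, one_pow, div_one]
    linarith [hsmall ht]
  · have hs : 1 ≤ Real.sqrt t := Real.one_le_sqrt.2 ht
    have hm : diffScale N t = min (N : ℝ) (Real.sqrt t) := max_eq_right (le_min hN' hs)
    have hm0 : 0 < min (N : ℝ) (Real.sqrt t) := by positivity
    rw [hm]
    refine (hlarge ht).trans ?_
    calc b / (N : ℝ) ^ n + c / Real.sqrt t ^ n
        ≤ b / min (N : ℝ) (Real.sqrt t) ^ n + c / min (N : ℝ) (Real.sqrt t) ^ n := by
          gcongr
          · exact min_le_left _ _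
          · exact min_le_right _ _
      _ = (b + c) / min (N : ℝ) (Real.sqrt t) ^ n := by ring
      _ ≤ _ := by gcongr; linarith

lemma sum_zmod_ne_zero (F : ℕ → ℝ) :
    ∑ k ∈ Finset.univ.erase (0 : ZMod N), F k.val = ∑ k ∈ Finset.Ico 1 N, F k := by
  refine Finset.sum_nbij ZMod.val ?_ (fun a _ b _ h => ZMod.val_injective N h) ?_ fun _ _ => rfl
  · intro a ha
    have : a.val ≠ 0 := by simpa using ha
    exact Finset.mem_Ico.2 ⟨Nat.one_le_iff_ne_zero.2 this, ZMod.val_lt a⟩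
  · intro k hk
    have hk' := Finset.mem_Ico.1 (Finset.mem_coe.1 hk)
    refine ⟨(k : ZMod N), ?_, ZMod.val_cast_of_lt hk'.2⟩
    have h : (k : ZMod N).val ≠ 0 := by rw [ZMod.val_cast_of_lt hk'.2]; omega
    simpa using fun h0 => h (by rw [h0]; simp)

/-- The weighted spectral sums that control the heat kernel of the circle and its gradients. -/
lemma exists_spectralSum_le (j : ℕ) : ∃ C : ℝ, 0 < C ∧ ∀ (N : ℕ) [NeZero N], 4 ≤ N →
    ∀ t : ℝ, 0 ≤ t → (1 / N : ℝ) * ∑ k ∈ Finset.univ.erase (0 : ZMod N),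
      halfSin k ^ j * Real.exp (-t * (1 - charRe k))
      ≤ C * Real.exp (-(circleGap N * t)) / diffScale N t ^ (j + 1) := by
  refine ⟨Real.exp 2 + 2 * 4 ^ j + j.factorial * Real.exp 1, by positivity, ?_⟩
  intro N _ hN t ht
  have hN0 : (0 : ℝ) < N := by exact_mod_cast (by omega : 0 < N)
  have hgap : circleGap N ≤ 2 := by
    have := Real.sin_sq_le_one (Real.pi / N)
    simp only [circleGap]; linarith
  set X := (1 / N : ℝ) * ∑ k ∈ Finset.Ico 1 N, Real.sin (Real.pi * k / N) ^ j
        * Real.exp (-t * (2 * Real.sin (Real.pi * k / N) ^ 2 - 2 * Real.sin (Real.pi / N) ^ 2))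
    with hX
  have hXeq : (1 / N : ℝ) * ∑ k ∈ Finset.univ.erase (0 : ZMod N),
      halfSin k ^ j * Real.exp (-t * (1 - charRe k)) = X * Real.exp (-(circleGap N * t)) := by
    rw [hX, mul_assoc, Finset.sum_mul, ← sum_zmod_ne_zero (N := N) fun k =>
      Real.sin (Real.pi * k / N) ^ j * Real.exp (-t * (2 * Real.sin (Real.pi * k / N) ^ 2
        - 2 * Real.sin (Real.pi / N) ^ 2)) * Real.exp (-(circleGap N * t))]
    congr 1
    refine Finset.sum_congr rfl fun k _ => ?_
    rw [mul_assoc, ← Real.exp_add, one_sub_charRe, halfSin, circleGap]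
    ring_nf
  have hXle : X ≤ (Real.exp 2 + 2 * 4 ^ j + j.factorial * Real.exp 1)
      / diffScale N t ^ (j + 1) := by
    refine le_div_diffScale (by omega) (by positivity) (by positivity) (by positivity) _ ?_ ?_
    -- For t ≤ 1 no cancellation is needed: each exponent is at most t times the gap, hence at most
    -- 2.
    · intro ht1
      have hterm : ∀ k ∈ Finset.Ico 1 N, Real.sin (Real.pi * k / N) ^ j
          * Real.exp (-t * (2 * Real.sin (Real.pi * k / N) ^ 2
            - 2 * Real.sin (Real.pi / N) ^ 2)) ≤ Real.exp 2 := by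
        intro k hk
        have hkN : (k : ℝ) ≤ N := by exact_mod_cast (Finset.mem_Ico.1 hk).2.le
        have hs0 : 0 ≤ Real.sin (Real.pi * k / N) :=
          Real.sin_nonneg_of_nonneg_of_le_pi (by positivity) (by
            rw [div_le_iff₀ hN0]; gcongr)
        have h1 : Real.sin (Real.pi * k / N) ^ j ≤ 1 := pow_le_one₀ hs0 (Real.sin_le_one _)
        have h2 : Real.exp (-t * (2 * Real.sin (Real.pi * k / N) ^ 2
            - 2 * Real.sin (Real.pi / N) ^ 2)) ≤ Real.exp 2 := by
          rw [Real.exp_le_exp]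
          simp only [circleGap] at hgap
          nlinarith [sq_nonneg (Real.sin (Real.pi * k / N)), sq_nonneg (Real.sin (Real.pi / N))]
        calc _ ≤ 1 * Real.exp 2 := mul_le_mul h1 h2 (Real.exp_pos _).le zero_le_one
          _ = _ := one_mul _
      have hsum := Finset.sum_le_card_nsmul _ _ _ hterm
      rw [Nat.card_Ico, nsmul_eq_mul] at hsum
      calc X ≤ (1 / N : ℝ) * (N * Real.exp 2) := by
            rw [hX]
            refine mul_le_mul_of_nonneg_left (hsum.trans ?_) (by positivity)
            gcongr
            omega
        _ = _ := by field_simp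
    · intro ht1
      exact sum_spectral_term_le j hN (by linarith)
  rw [hXeq]
  calc _ ≤ _ := mul_le_mul_of_nonneg_right hXle (Real.exp_pos _).le
    _ = _ := by ring

/-! ### The circle kernel and its differences -/

/-- The heat kernel of the circle `ℤ/Nℤ`, for jumps to each neighbour at rate `1/2`. -/
def circleKernel (t : ℝ) (j : ZMod N) : ℝ :=
  (1 / N : ℝ) * ∑ k : ZMod N, Real.exp (-t * (1 - charRe k)) * charRe (k * j)

lemma circleKernel_zero (j : ZMod N) : circleKernel 0 j = if j = 0 then 1 else 0 := by
  have hN : (N : ℝ) ≠ 0 := Nat.cast_ne_zero.2 (NeZero.ne N)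
  simp only [circleKernel, neg_zero, zero_mul, Real.exp_zero, one_mul, sum_charRe_mul]
  split_ifs <;> simp [hN]

lemma circleKernel_neg (t : ℝ) (j : ZMod N) : circleKernel t (-j) = circleKernel t j := by
  simp only [circleKernel, mul_neg, charRe_neg]

lemma hasDerivAt_circleKernel (t : ℝ) (j : ZMod N) :
    HasDerivAt (fun t => circleKernel t j)
      ((1 / 2) * (circleKernel t (j + 1) + circleKernel t (j - 1) - 2 * circleKernel t j)) t := by
  have h : HasDerivAt (fun t => circleKernel t j) ((1 / N : ℝ) * ∑ k : ZMod N,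
      (Real.exp (-t * (1 - charRe k)) * (-1 * (1 - charRe k))) * charRe (k * j)) t := by
    refine HasDerivAt.const_mul _ (HasDerivAt.fun_sum fun k _ => HasDerivAt.mul_const ?_ _)
    exact HasDerivAt.exp (((hasDerivAt_id t).neg).mul_const _)
  convert h using 1
  simp only [circleKernel]
  rw [← mul_add, mul_left_comm (2 : ℝ), ← mul_sub, mul_left_comm, Finset.mul_sum,
    ← Finset.sum_add_distrib, ← Finset.sum_sub_distrib, Finset.mul_sum]
  congr 1
  refine Finset.sum_congr rfl fun k _ => ?_
  have := charRe_add_add_charRe_sub (k * j) k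
  rw [mul_add k j 1, mul_sub k j 1, mul_one k]
  linear_combination (1 / 2 * Real.exp (-t * (1 - charRe k))) * this

/-- The zero mode is the only one that does not decay. It cancels in every difference, which is why
differences carry the factor exp(-gap * t). -/
lemma circleKernel_eq (t : ℝ) (j : ZMod N) : circleKernel t j = 1 / N
    + (1 / N : ℝ) * ∑ k ∈ Finset.univ.erase (0 : ZMod N),
      Real.exp (-t * (1 - charRe k)) * charRe (k * j) := by
  rw [circleKernel, ← Finset.add_sum_erase _ _ (Finset.mem_univ (0 : ZMod N)), mul_add,
    zero_mul, charRe_zero, sub_self, mul_zero, Real.exp_zero, one_mul, mul_one]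

lemma inv_le_circleKernel (t : ℝ) : 1 / (N : ℝ) ≤ circleKernel t (0 : ZMod N) := by
  rw [circleKernel_eq]
  refine le_add_of_nonneg_right (mul_nonneg (by positivity) (Finset.sum_nonneg fun k _ => ?_))
  rw [mul_zero, charRe_zero, mul_one]
  exact (Real.exp_pos _).le

/-- Heat kernel bounds on the circle, up to second order differences. -/
lemma exists_circleKernel_bounds : ∃ C : ℝ, 1 ≤ C ∧ ∀ (N : ℕ) [NeZero N], 4 ≤ N →
    ∀ (t : ℝ) (j : ZMod N), 0 ≤ t →
      |circleKernel t j| ≤ C / diffScale N t ∧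
      circleKernel t (0 : ZMod N) - 1 / N ≤ C * Real.exp (-(circleGap N * t)) / diffScale N t ∧
      |circleKernel t (j + 1) - circleKernel t j|
        ≤ C * Real.exp (-(circleGap N * t)) / diffScale N t ^ 2 ∧
      |circleKernel t (j + 1) + circleKernel t (j - 1) - 2 * circleKernel t j|
        ≤ C * Real.exp (-(circleGap N * t)) / diffScale N t ^ 3 := by
  obtain ⟨C0, hC0, h0⟩ := exists_spectralSum_le 0
  obtain ⟨C1, hC1, h1⟩ := exists_spectralSum_le 1
  obtain ⟨C2, hC2, h2⟩ := exists_spectralSum_le 2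
  refine ⟨1 + C0 + 2 * C1 + 4 * C2, by linarith, ?_⟩
  intro N _ hN t j ht
  specialize h0 N hN t ht
  specialize h1 N hN t ht
  specialize h2 N hN t ht
  simp only [pow_zero, one_mul, zero_add, pow_one, Nat.reduceAdd] at h0 h1 h2
  have hN0 : (1 : ℝ) ≤ N := by exact_mod_cast (by omega : 1 ≤ N)
  have hm := diffScale_pos N t
  have hmN : diffScale N t ≤ N := max_le hN0 (min_le_left _ _)
  have hgap0 : 0 ≤ circleGap N := by simp only [circleGap]; positivity
  have hexp1 : Real.exp (-(circleGap N * t)) ≤ 1 := Real.exp_le_one_iff.2 (by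
    have := mul_nonneg hgap0 ht; linarith)
  have hexp0 := Real.exp_pos (-(circleGap N * t))
  have hb0 : ∀ j : ZMod N, |(1 / N : ℝ) * ∑ k ∈ Finset.univ.erase (0 : ZMod N),
      Real.exp (-t * (1 - charRe k)) * charRe (k * j)|
      ≤ C0 * Real.exp (-(circleGap N * t)) / diffScale N t := by
    intro j
    refine (abs_spectral_le _ fun k _ => ?_).trans h0
    rw [abs_mul, Real.abs_exp]
    exact mul_le_of_le_one_right (Real.exp_pos _).le (abs_charRe_le_one _)
  refine ⟨?_, ?_, ?_, ?_⟩
  · rw [circleKernel_eq]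
    refine (abs_add_le _ _).trans ?_
    calc _ ≤ 1 / diffScale N t + C0 * 1 / diffScale N t := by
          rw [abs_of_nonneg (by positivity : (0 : ℝ) ≤ 1 / N)]
          refine add_le_add (by gcongr) ((hb0 j).trans (by gcongr))
      _ = (1 + C0) / diffScale N t := by ring
      _ ≤ _ := div_le_div_of_nonneg_right (by linarith) hm.le
  · rw [circleKernel_eq, add_sub_cancel_left]
    refine (le_abs_self _).trans ((hb0 0).trans ?_)
    have : C0 ≤ 1 + C0 + 2 * C1 + 4 * C2 := by linarith
    gcongr
  · have : circleKernel t (j + 1) - circleKernel t j = (1 / N : ℝ)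
        * ∑ k ∈ Finset.univ.erase (0 : ZMod N),
          Real.exp (-t * (1 - charRe k)) * (charRe (k * j + k) - charRe (k * j)) := by
      rw [circleKernel_eq, circleKernel_eq, add_sub_add_left_eq_sub, ← mul_sub,
        ← Finset.sum_sub_distrib]
      simp only [mul_add, mul_one, mul_sub]
    rw [this]
    refine (abs_spectral_le (F := fun k => 2 * (halfSin k * Real.exp (-t * (1 - charRe k))))
      _ fun k _ => ?_).trans ?_
    · rw [abs_mul, Real.abs_exp]
      have := mul_le_mul_of_nonneg_left (abs_charRe_add_sub_le (k * j) k)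
        (Real.exp_pos (-t * (1 - charRe k))).le
      linarith
    · rw [← Finset.mul_sum, mul_left_comm]
      calc _ ≤ 2 * (C1 * Real.exp (-(circleGap N * t)) / diffScale N t ^ 2) := by gcongr
        _ = 2 * C1 * Real.exp (-(circleGap N * t)) / diffScale N t ^ 2 := by ring
        _ ≤ _ := by gcongr; linarith
  -- The second difference multiplies mode `k` by 2(Re χ(k) - 1) = -4 `halfSin k` ^ 2, so the
  -- spectral sum with exponent 2 applies.
  · have : circleKernel t (j + 1) + circleKernel t (j - 1) - 2 * circleKernel t j = (1 / N : ℝ)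
        * ∑ k ∈ Finset.univ.erase (0 : ZMod N),
          Real.exp (-t * (1 - charRe k)) * (-4 * halfSin k ^ 2 * charRe (k * j)) := by
      have : ∀ k : ZMod N, Real.exp (-t * (1 - charRe k)) * (-4 * halfSin k ^ 2 * charRe (k * j))
          = Real.exp (-t * (1 - charRe k)) * charRe (k * (j + 1))
            + Real.exp (-t * (1 - charRe k)) * charRe (k * (j - 1))
            - 2 * (Real.exp (-t * (1 - charRe k)) * charRe (k * j)) := by
        intro k
        have h3 := charRe_add_add_charRe_sub (k * j) k
        have h4 := one_sub_charRe k
        rw [mul_add k j 1, mul_sub k j 1, mul_one k]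
        linear_combination (-Real.exp (-t * (1 - charRe k))) * h3
          + (2 * Real.exp (-t * (1 - charRe k)) * charRe (k * j)) * h4
      rw [circleKernel_eq, circleKernel_eq, circleKernel_eq]
      simp only [this, Finset.sum_add_distrib, Finset.sum_sub_distrib, ← Finset.mul_sum]
      ring
    rw [this]
    refine (abs_spectral_le (F := fun k => 4 * (halfSin k ^ 2 * Real.exp (-t * (1 - charRe k))))
      _ fun k _ => ?_).trans ?_
    · rw [abs_mul, Real.abs_exp, abs_mul, abs_mul, abs_neg, abs_of_nonneg (sq_nonneg (halfSin k)),
        abs_of_pos (by norm_num : (0 : ℝ) < 4)]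
      have := mul_le_mul_of_nonneg_left (abs_charRe_le_one (k * j))
        (by positivity : 0 ≤ Real.exp (-t * (1 - charRe k)) * (4 * halfSin k ^ 2))
      linarith
    · rw [← Finset.mul_sum, mul_left_comm]
      calc _ ≤ 4 * (C2 * Real.exp (-(circleGap N * t)) / diffScale N t ^ 3) := by gcongr
        _ = 4 * C2 * Real.exp (-(circleGap N * t)) / diffScale N t ^ 3 := by ring
        _ ≤ _ := by gcongr; linarith

end Circle

/-! ### The Laplacian and the heat kernel of the torus -/

section TorusKernel

variable {d N : ℕ} [NeZero N]

/-- The unit vector of the torus in the direction `i`. -/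
def unitVec (i : Fin d) : Torus d N := Pi.single i 1

/-- The increment of `a` along the oriented edge `x → x + e_i`. -/
def grad (a : Torus d N → ℝ) (e : Torus d N × Fin d) : ℝ := a (e.1 + unitVec e.2) - a e.1

/-- The Laplacian of the torus, normalized as the generator of the random walk. -/
def laplacian (a : Torus d N → ℝ) (x : Torus d N) : ℝ :=
  (1 / 2) * ∑ i, (a (x + unitVec i) + a (x - unitVec i) - 2 * a x)

lemma adj_iff {x y : Torus d N} (hN : 3 ≤ N) : (torusGraph d N).Adj x y ↔
    ∃ i, y = x + unitVec i ∨ y = x - unitVec i := by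
  have : Fact (1 < N) := ⟨by omega⟩
  simp only [torusGraph, SimpleGraph.fromRel_adj, unitVec]
  constructor
  · rintro ⟨-, ⟨i, h⟩ | ⟨i, h⟩⟩
    · exact ⟨i, Or.inl h⟩
    · exact ⟨i, Or.inr (by rw [h, add_sub_cancel_right])⟩
  · rintro ⟨i, h | h⟩
    · refine ⟨fun hxy => ?_, Or.inl ⟨i, h⟩⟩
      have := congrFun (hxy.trans h) i
      simp at this
    · refine ⟨fun hxy => ?_, Or.inr ⟨i, by rw [h, sub_add_cancel]⟩⟩
      have := congrFun (hxy.trans h) i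
      simp [eq_comm (a := x i), sub_eq_self] at this

lemma unitVec_injective (hN : 3 ≤ N) : Function.Injective (unitVec : Fin d → Torus d N) := by
  have : Fact (1 < N) := ⟨by omega⟩
  intro i j h
  by_contra hij
  have := congrFun h i
  simp [unitVec, hij] at this

lemma unitVec_ne_neg (hN : 3 ≤ N) (i j : Fin d) : (unitVec i : Torus d N) ≠ -unitVec j := by
  have : Fact (1 < N) := ⟨by omega⟩
  intro h
  have h1 := congrFun h i
  by_cases hij : i = j
  · subst hij
    simp only [unitVec, Pi.single_eq_same, Pi.neg_apply] at h1
    have h2 : ((2 : ℕ) : ZMod N) = 0 := by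
      push_cast
      linear_combination h1
    rw [ZMod.natCast_eq_zero_iff] at h2
    exact absurd (Nat.le_of_dvd two_pos h2) (by omega)
  · simp [unitVec, hij] at h1

-- The condition N ≥ 3 makes the 2d neighbours distinct; for N = 2 the steps +1 and -1 coincide and
-- would be counted twice.
open Classical in
lemma sum_adj (hN : 3 ≤ N) (x : Torus d N) (F : Torus d N → ℝ) :
    ∑ y, (if (torusGraph d N).Adj x y then F y else 0)
      = ∑ i, (F (x + unitVec i) + F (x - unitVec i)) := by
  have h : ∑ i, (F (x + unitVec i) + F (x - unitVec i)) = ∑ s : Fin d ⊕ Fin d,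
      F (x + Sum.elim (fun i => unitVec i) (fun i => -unitVec i) s) := by
    rw [Fintype.sum_sum_type, Finset.sum_add_distrib]
    simp only [Sum.elim_inl, Sum.elim_inr, sub_eq_add_neg]
  rw [h, ← Finset.sum_filter]
  symm
  refine Finset.sum_nbij (fun s => x + Sum.elim (fun i => unitVec i) (fun i => -unitVec i) s)
    ?_ ?_ ?_ fun _ _ => rfl
  · rintro (i | i) -
    · simpa [adj_iff hN] using ⟨i, Or.inl rfl⟩
    · simpa [adj_iff hN, ← sub_eq_add_neg] using ⟨i, Or.inr rfl⟩
  · rintro (i | i) - (j | j) - hij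
    · exact congrArg _ (unitVec_injective hN (add_left_cancel hij))
    · exact absurd (add_left_cancel hij) (unitVec_ne_neg hN i j)
    · exact absurd (add_left_cancel hij).symm (unitVec_ne_neg hN j i)
    · exact congrArg _ (unitVec_injective hN (neg_injective (add_left_cancel hij)))
  · intro y hy
    have := (adj_iff hN).1 (Finset.mem_filter.1 (Finset.mem_coe.1 hy)).2
    obtain ⟨i, h | h⟩ := this
    · exact ⟨Sum.inl i, by simp, by simp [h]⟩
    · exact ⟨Sum.inr i, by simp, by simp [h, sub_eq_add_neg]⟩

lemma rwGenerator_apply (hN : 3 ≤ N) (a : Torus d N → ℝ) (x : Torus d N) :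
    rwGenerator d N a x = laplacian a x := by
  simp only [rwGenerator, LinearMap.coe_mk, AddHom.coe_mk, laplacian]
  rw [sum_adj hN x fun y => a y - a x]
  congr 1
  exact Finset.sum_congr rfl fun i _ => by ring

lemma sum_add_unitVec (F : Torus d N → ℝ) (v : Torus d N) : ∑ x, F (x + v) = ∑ x, F x :=
  Equiv.sum_comp (Equiv.addRight v) F

/-- Summation by parts; the factor 2 compensates the 1/2 in `laplacian`. -/
lemma sum_grad_mul_grad (a b : Torus d N → ℝ) :
    ∑ e, grad a e * grad b e = -2 * ∑ x, a x * laplacian b x := by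
  have key : ∀ i : Fin d, ∑ x, grad a (x, i) * grad b (x, i)
      = -∑ x, a x * (b (x + unitVec i) + b (x - unitVec i) - 2 * b x) := by
    intro i
    have h1 := sum_add_unitVec (fun x => a x * b x) (unitVec i)
    have h2 := sum_add_unitVec (fun x => a x * b (x - unitVec i)) (unitVec i)
    simp only [add_sub_cancel_right] at h2
    simp only [grad, mul_sub, sub_mul, mul_add, Finset.sum_sub_distrib, Finset.sum_add_distrib]
    simp only [mul_left_comm _ (2 : ℝ), ← Finset.mul_sum]
    linarith
  rw [Fintype.sum_prod_type_right]
  simp only [key, laplacian]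
  rw [Finset.sum_neg_distrib, Finset.sum_comm]
  simp only [mul_left_comm _ (1 / 2 : ℝ), ← Finset.mul_sum]
  ring

lemma sum_mul_laplacian_comm (a b : Torus d N → ℝ) :
    ∑ x, a x * laplacian b x = ∑ x, laplacian a x * b x := by
  have h1 := sum_grad_mul_grad a b
  have h2 := sum_grad_mul_grad b a
  simp only [mul_comm (grad b _)] at h2
  simp only [mul_comm (laplacian a _)]
  linarith

lemma laplacian_comp_sub_left (a : Torus d N → ℝ) (v x : Torus d N) :
    laplacian (fun z => a (v - z)) x = laplacian a (v - x) := by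
  simp only [laplacian]
  congr 1
  refine Finset.sum_congr rfl fun i _ => ?_
  rw [show v - (x + unitVec i) = v - x - unitVec i by abel,
    show v - (x - unitVec i) = v - x + unitVec i by abel]
  ring

lemma laplacian_sub (a b : Torus d N → ℝ) (x : Torus d N) :
    laplacian (fun z => a z - b z) x = laplacian a x - laplacian b x := by
  simp only [laplacian, ← mul_sub, ← Finset.sum_sub_distrib]
  congr 1
  exact Finset.sum_congr rfl fun i _ => by ring

/-- The energy dissipation identity. It converts time integrals of squared gradients into ℓ² norms,
and so bounds the masses of both the source and the kernel of the renewal equation. -/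
lemma hasDerivAt_sum_sq {a : ℝ → Torus d N → ℝ} {r : ℝ}
    (h : ∀ x, HasDerivAt (fun r => a r x) (laplacian (a r) x) r) :
    HasDerivAt (fun r => ∑ x, a r x ^ 2) (-∑ e, grad (a r) e ^ 2) r := by
  have h1 : HasDerivAt (fun r => ∑ x, a r x ^ 2)
      (∑ x, (laplacian (a r) x * a r x + a r x * laplacian (a r) x)) r := by
    refine HasDerivAt.fun_sum fun x _ => ?_
    simp only [pow_two]
    exact (h x).mul (h x)
  convert h1 using 1
  have h2 := sum_grad_mul_grad (a r) (a r)
  simp only [pow_two, h2, Finset.sum_add_distrib, mul_comm (laplacian (a r) _)]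
  ring

/-- The heat kernel of the torus. -/
def torusKernel (t : ℝ) (x : Torus d N) : ℝ := ∏ i, circleKernel t (x i)

lemma torusKernel_zero (x : Torus d N) : torusKernel 0 x = if x = 0 then 1 else 0 := by
  simp only [torusKernel, circleKernel_zero]
  rw [Finset.prod_ite_zero]
  simp [funext_iff]

lemma torusKernel_neg (t : ℝ) (x : Torus d N) : torusKernel t (-x) = torusKernel t x := by
  simp only [torusKernel, Pi.neg_apply, circleKernel_neg]

lemma prod_erase_congr (t : ℝ) {x y : Torus d N} {s : Finset (Fin d)} (h : ∀ k ∈ s, x k = y k) :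
    ∏ k ∈ s, circleKernel t (x k) = ∏ k ∈ s, circleKernel t (y k) :=
  Finset.prod_congr rfl fun k hk => by rw [h k hk]

lemma torusKernel_eq_mul_prod_erase (t : ℝ) (x : Torus d N) (i : Fin d) :
    torusKernel t x = circleKernel t (x i) * ∏ k ∈ Finset.univ.erase i, circleKernel t (x k) :=
  (Finset.mul_prod_erase _ _ (Finset.mem_univ i)).symm

lemma torusKernel_add_unitVec (t : ℝ) (x : Torus d N) (i : Fin d) :
    torusKernel t (x + unitVec i)
      = circleKernel t (x i + 1) * ∏ k ∈ Finset.univ.erase i, circleKernel t (x k) := by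
  rw [torusKernel_eq_mul_prod_erase t _ i, prod_erase_congr t (y := x)]
  · simp [unitVec]
  · intro k hk
    simp [unitVec, Finset.ne_of_mem_erase hk]

lemma torusKernel_sub_unitVec (t : ℝ) (x : Torus d N) (i : Fin d) :
    torusKernel t (x - unitVec i)
      = circleKernel t (x i - 1) * ∏ k ∈ Finset.univ.erase i, circleKernel t (x k) := by
  rw [torusKernel_eq_mul_prod_erase t _ i, prod_erase_congr t (y := x)]
  · simp [unitVec]
  · intro k hk
    simp [unitVec, Finset.ne_of_mem_erase hk]

lemma hasDerivAt_torusKernel (t : ℝ) (x : Torus d N) :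
    HasDerivAt (fun t => torusKernel t x) (laplacian (torusKernel t) x) t := by
  have h := HasDerivAt.fun_finsetProd (u := Finset.univ)
    fun (i : Fin d) _ => hasDerivAt_circleKernel t (x i)
  refine h.congr_deriv ?_
  simp only [laplacian]
  rw [Finset.mul_sum]
  symm
  refine Finset.sum_congr rfl fun i _ => ?_
  rw [torusKernel_add_unitVec, torusKernel_sub_unitVec, torusKernel_eq_mul_prod_erase t x i,
    smul_eq_mul]
  ring

/-- The Chapman–Kolmogorov equation. -/
lemma sum_torusKernel_mul (r s : ℝ) (x : Torus d N) :
    ∑ z, torusKernel r (x - z) * torusKernel s z = torusKernel (r + s) x := by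
  -- Interpolation between the two sides: moving time from one factor to the other leaves the sum
  -- constant, because the Laplacian is self-adjoint.
  set H : ℝ → ℝ := fun u => ∑ z, torusKernel u (x - z) * torusKernel (r + s - u) z
  have hd : ∀ u, HasDerivAt H 0 u := by
    intro u
    have h : HasDerivAt H (∑ z, (laplacian (torusKernel u) (x - z) * torusKernel (r + s - u) z
        + torusKernel u (x - z) * (laplacian (torusKernel (r + s - u)) z * -1))) u := by
      refine HasDerivAt.fun_sum fun z _ => (hasDerivAt_torusKernel u (x - z)).mul ?_
      exact (hasDerivAt_torusKernel (r + s - u) z).comp u ((hasDerivAt_id u).const_sub (r + s))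
    convert h using 1
    have := sum_mul_laplacian_comm (fun z => torusKernel u (x - z)) (torusKernel (r + s - u))
    simp only [laplacian_comp_sub_left] at this
    simp only [Finset.sum_add_distrib, mul_neg, mul_one, Finset.sum_neg_distrib]
    linarith
  have hc := is_const_of_deriv_eq_zero (fun u => (hd u).differentiableAt)
    (fun u => (hd u).deriv) r 0
  simp only [H, add_sub_cancel_left, sub_zero, torusKernel_zero, sub_eq_zero, ite_mul, one_mul,
    zero_mul, Finset.sum_ite_eq, Finset.mem_univ, if_true] at hc
  exact hc

/-- The heat flow, at time `r`, from the signed unit masses at the ends of the edge `f`. -/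
def edgeFlow (r : ℝ) (f : Torus d N × Fin d) (z : Torus d N) : ℝ :=
  torusKernel r (f.1 + unitVec f.2 - z) - torusKernel r (f.1 - z)

lemma hasDerivAt_edgeFlow (r : ℝ) (f : Torus d N × Fin d) (z : Torus d N) :
    HasDerivAt (fun r => edgeFlow r f z) (laplacian (edgeFlow r f) z) r := by
  refine ((hasDerivAt_torusKernel r (f.1 + unitVec f.2 - z)).sub
    (hasDerivAt_torusKernel r (f.1 - z))).congr_deriv ?_
  rw [← laplacian_comp_sub_left, ← laplacian_comp_sub_left, ← laplacian_sub]
  rfl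

lemma sum_mul_edgeFlow_zero (a : Torus d N → ℝ) (f : Torus d N × Fin d) :
    ∑ z, a z * edgeFlow 0 f z = grad a f := by
  simp [edgeFlow, torusKernel_zero, sub_eq_zero, mul_sub, grad]

lemma edgeFlow_apply_zero (r : ℝ) (f : Torus d N × Fin d) :
    edgeFlow r f 0 = grad (torusKernel r) f := by
  simp [edgeFlow, grad]

/-- The mixed second difference of the heat kernel. -/
lemma grad_edgeFlow (r : ℝ) (e f : Torus d N × Fin d) : grad (edgeFlow r f) e
    = torusKernel r (f.1 - e.1 + unitVec f.2 - unitVec e.2)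
      - torusKernel r (f.1 - e.1 - unitVec e.2) - torusKernel r (f.1 - e.1 + unitVec f.2)
      + torusKernel r (f.1 - e.1) := by
  simp only [grad, edgeFlow]
  rw [show f.1 + unitVec f.2 - (e.1 + unitVec e.2) = f.1 - e.1 + unitVec f.2 - unitVec e.2 by abel,
    show f.1 - (e.1 + unitVec e.2) = f.1 - e.1 - unitVec e.2 by abel,
    show f.1 + unitVec f.2 - e.1 = f.1 - e.1 + unitVec f.2 by abel]
  ring

/-- The heat kernel is even. This symmetry lets one mass estimate serve for both marginals of the
renewal kernel. -/
lemma grad_edgeFlow_comm (r : ℝ) (e f : Torus d N × Fin d) :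
    grad (edgeFlow r f) e = grad (edgeFlow r e) f := by
  rw [grad_edgeFlow, grad_edgeFlow, ← torusKernel_neg r (f.1 - e.1 + unitVec f.2 - unitVec e.2),
    ← torusKernel_neg r (f.1 - e.1 - unitVec e.2), ← torusKernel_neg r (f.1 - e.1 + unitVec f.2),
    ← torusKernel_neg r (f.1 - e.1),
    show -(f.1 - e.1 + unitVec f.2 - unitVec e.2) = e.1 - f.1 + unitVec e.2 - unitVec f.2 by abel,
    show -(f.1 - e.1 - unitVec e.2) = e.1 - f.1 + unitVec e.2 by abel,
    show -(f.1 - e.1 + unitVec f.2) = e.1 - f.1 - unitVec f.2 by abel,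
    show -(f.1 - e.1) = e.1 - f.1 by abel]
  ring

lemma sum_torusKernel_sub_mul (r : ℝ) (x y : Torus d N) :
    ∑ z, torusKernel r (x - z) * torusKernel r (y - z) = torusKernel (2 * r) (x - y) := by
  rw [two_mul, ← sum_torusKernel_mul, ← sum_add_unitVec _ y]
  refine Finset.sum_congr rfl fun z _ => ?_
  rw [← torusKernel_neg r z, show x - (z + y) = x - y - z by abel,
    show y - (z + y) = -z by abel]

lemma sum_torusKernel_sq (r : ℝ) :
    ∑ z : Torus d N, torusKernel r z ^ 2 = torusKernel (2 * r) (0 : Torus d N) := by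
  have := sum_torusKernel_sub_mul r (0 : Torus d N) 0
  simpa [torusKernel_neg, pow_two] using this

/-- Expand the square and apply Chapman–Kolmogorov. The ℓ² norm becomes a single first difference of
the kernel, so it decays one power of `diffScale` faster than the kernel itself. -/
lemma sum_edgeFlow_sq (r : ℝ) (f : Torus d N × Fin d) :
    ∑ z, edgeFlow r f z ^ 2 = -2 * grad (torusKernel (2 * r)) ((0 : Torus d N), f.2) := by
  have h : ∀ z, edgeFlow r f z ^ 2
      = torusKernel r (f.1 + unitVec f.2 - z) * torusKernel r (f.1 + unitVec f.2 - z)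
      - 2 * (torusKernel r (f.1 + unitVec f.2 - z) * torusKernel r (f.1 - z))
      + torusKernel r (f.1 - z) * torusKernel r (f.1 - z) := fun z => by
    simp only [edgeFlow]; ring
  simp only [h, Finset.sum_add_distrib, Finset.sum_sub_distrib, ← Finset.mul_sum,
    sum_torusKernel_sub_mul, sub_self, add_sub_cancel_left, grad, zero_add]
  ring

lemma pow_sub_pow_le_mul {a b : ℝ} (hb : 0 ≤ b) (hab : b ≤ a) (n : ℕ) :
    a ^ n - b ^ n ≤ n * a ^ (n - 1) * (a - b) := by
  have ha := hb.trans hab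
  rw [← geom_sum₂_mul a b n]
  refine mul_le_mul_of_nonneg_right ?_ (by linarith)
  calc _ ≤ ∑ i ∈ Finset.range n, a ^ (n - 1) := by
        refine Finset.sum_le_sum fun i hi => ?_
        have hi' := Finset.mem_range.1 hi
        calc a ^ i * b ^ (n - 1 - i) ≤ a ^ i * a ^ (n - 1 - i) := by gcongr
          _ = a ^ (n - 1) := by rw [← pow_add]; congr 1; omega
    _ = _ := by simp

lemma abs_prod_circleKernel_le {C m t : ℝ} (h : ∀ j : ZMod N, |circleKernel t j| ≤ C / m)
    (s : Finset (Fin d)) (x : Torus d N) :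
    |∏ k ∈ s, circleKernel t (x k)| ≤ (C / m) ^ s.card := by
  rw [Finset.abs_prod]
  rw [← Finset.prod_const]
  exact Finset.prod_le_prod (fun k _ => abs_nonneg _) fun k _ => h _

variable (d) in
/-- Heat kernel bounds on the torus, up to second order differences. -/
lemma exists_torusKernel_bounds : ∃ C : ℝ, 1 ≤ C ∧ ∀ (N : ℕ) [NeZero N], 4 ≤ N →
    ∀ t : ℝ, 0 ≤ t →
      (torusKernel t (0 : Torus d N) - 1 / (N : ℝ) ^ d
        ≤ C * Real.exp (-(circleGap N * t)) / diffScale N t ^ d) ∧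
      (∀ e : Torus d N × Fin d, |grad (torusKernel t) e|
        ≤ C * Real.exp (-(circleGap N * t)) / diffScale N t ^ (d + 1)) ∧
      ∀ e f : Torus d N × Fin d, |grad (edgeFlow t f) e|
        ≤ C * Real.exp (-(circleGap N * t)) / diffScale N t ^ (d + 2) := by
  obtain ⟨C, hC, hb⟩ := exists_circleKernel_bounds
  refine ⟨(d + 1) * C ^ d, ?_, ?_⟩
  · have : (1 : ℝ) ≤ C ^ d := one_le_pow₀ hC
    nlinarith [(Nat.cast_nonneg d : (0 : ℝ) ≤ d)]
  intro N _ hN t ht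
  have hC0 : 0 < C := by linarith
  have hm := diffScale_pos N t
  set m := diffScale N t with hmdef
  set E := Real.exp (-(circleGap N * t)) with hE
  have hE0 : 0 < E := Real.exp_pos _
  have hE1 : E ≤ 1 := by
    have hgap0 : 0 ≤ circleGap N := by simp only [circleGap]; positivity
    exact Real.exp_le_one_iff.2 (by have := mul_nonneg hgap0 ht; linarith)
  have h0 : ∀ j : ZMod N, |circleKernel t j| ≤ C / m := fun j => (hb N hN t j ht).1
  have h1 : ∀ j : ZMod N, |circleKernel t (j + 1) - circleKernel t j| ≤ C * E / m ^ 2 :=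
    fun j => (hb N hN t j ht).2.2.1
  have h2 : ∀ j : ZMod N, |circleKernel t (j + 1) + circleKernel t (j - 1) - 2 * circleKernel t j|
      ≤ C * E / m ^ 3 := fun j => (hb N hN t j ht).2.2.2
  have hd0 : (0 : ℝ) ≤ d := Nat.cast_nonneg d
  have hCd : C ^ d ≤ (d + 1) * C ^ d := by nlinarith [pow_pos hC0 d]
  have hfin : ∀ n : ℕ, C ^ d * E / m ^ n ≤ (d + 1) * C ^ d * E / m ^ n := fun n => by gcongr
  refine ⟨?_, ?_, ?_⟩
  · have hd1 : circleKernel t (0 : ZMod N) - 1 / N ≤ C * E / m := (hb N hN t 0 ht).2.1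
    have hprod : torusKernel t (0 : Torus d N) = circleKernel t (0 : ZMod N) ^ d := by
      simp [torusKernel]
    have hq := inv_le_circleKernel (N := N) t
    rw [hprod, ← one_div_pow]
    refine (pow_sub_pow_le_mul (by positivity) hq d).trans ?_
    rcases Nat.eq_zero_or_pos d with rfl | hdpos
    · simp only [Nat.cast_zero, zero_mul, pow_zero]; positivity
    calc d * circleKernel t (0 : ZMod N) ^ (d - 1) * (circleKernel t (0 : ZMod N) - 1 / N)
        ≤ d * (C / m) ^ (d - 1) * (C * E / m) := by
          have hq0 : 0 ≤ circleKernel t (0 : ZMod N) := le_trans (by positivity) hq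
          have := (le_abs_self _).trans (h0 0)
          have hq1 : 0 ≤ circleKernel t (0 : ZMod N) - 1 / N := by linarith
          gcongr
      _ = d * (C ^ d * E / m ^ d) := by
          obtain ⟨n, rfl⟩ := Nat.exists_eq_succ_of_ne_zero hdpos.ne'
          rw [Nat.succ_sub_one, div_pow, pow_succ, pow_succ]
          field_simp
      _ ≤ (d + 1) * (C ^ d * E / m ^ d) := by gcongr; linarith
      _ = _ := by ring
  · rintro ⟨x, i⟩
    have hdpos : 0 < d := i.pos
    simp only [grad]
    rw [torusKernel_add_unitVec, torusKernel_eq_mul_prod_erase t x i, ← sub_mul, abs_mul]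
    refine le_trans ?_ (hfin _)
    have hp := abs_prod_circleKernel_le h0 (Finset.univ.erase i) x
    rw [Finset.card_erase_of_mem (Finset.mem_univ i), Finset.card_univ, Fintype.card_fin] at hp
    calc _ ≤ C * E / m ^ 2 * (C / m) ^ (d - 1) := by
          gcongr
          exact h1 _
      _ = _ := by
          obtain ⟨n, rfl⟩ := Nat.exists_eq_succ_of_ne_zero hdpos.ne'
          simp only [Nat.succ_sub_one, div_pow, Nat.succ_eq_add_one, pow_add]
          field_simp
  · rintro ⟨y, j⟩ ⟨x, i⟩
    have hdpos : 0 < d := i.pos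
    refine le_trans ?_ (hfin _)
    rw [grad_edgeFlow]
    set v := x - y
    simp only
    -- Parallel edges give a second difference of one circle factor. Otherwise two distinct factors
    -- are differenced once each; both carry the exponential, and one of them is bounded by 1.
    by_cases hij : i = j
    · subst hij
      have hp := abs_prod_circleKernel_le h0 (Finset.univ.erase i) v
      rw [Finset.card_erase_of_mem (Finset.mem_univ i), Finset.card_univ, Fintype.card_fin] at hp
      rw [add_sub_cancel_right, torusKernel_add_unitVec, torusKernel_sub_unitVec,
        torusKernel_eq_mul_prod_erase t v i]
      set R := ∏ k ∈ Finset.univ.erase i, circleKernel t (v k)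
      calc _ = |circleKernel t (v i + 1) + circleKernel t (v i - 1) - 2 * circleKernel t (v i)|
            * |R| := by rw [← abs_mul, ← abs_neg]; congr 1; ring
        _ ≤ C * E / m ^ 3 * (C / m) ^ (d - 1) := by
            gcongr
            exact h2 _
        _ = _ := by
            obtain ⟨n, rfl⟩ := Nat.exists_eq_succ_of_ne_zero hdpos.ne'
            simp only [Nat.succ_sub_one, div_pow, Nat.succ_eq_add_one, pow_add]
            field_simp
    · have hji : j ≠ i := fun h => hij h.symm
      have hmem : j ∈ Finset.univ.erase i := Finset.mem_erase.2 ⟨hji, Finset.mem_univ j⟩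
      have hcard : ((Finset.univ.erase i).erase j).card = d - 2 := by
        rw [Finset.card_erase_of_mem hmem, Finset.card_erase_of_mem (Finset.mem_univ i),
          Finset.card_univ, Fintype.card_fin]
        omega
      have hd2 : 2 ≤ d := by
        have := Finset.card_pos.2 ⟨j, hmem⟩
        rw [Finset.card_erase_of_mem (Finset.mem_univ i), Finset.card_univ,
          Fintype.card_fin] at this
        omega
      have hp := abs_prod_circleKernel_le h0 ((Finset.univ.erase i).erase j) v
      rw [hcard] at hp
      set R := ∏ k ∈ (Finset.univ.erase i).erase j, circleKernel t (v k) with hR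
      have hsub : ∀ w : Torus d N, (∀ k, k ≠ i → w k = (v - unitVec j : Torus d N) k) →
          ∏ k ∈ Finset.univ.erase i, circleKernel t (w k) = circleKernel t (v j - 1) * R := by
        intro w hw
        rw [← Finset.mul_prod_erase _ _ hmem, hw j hji, hR]
        congr 1
        · simp [unitVec]
        · refine prod_erase_congr t fun k hk => ?_
          have hkj := Finset.ne_of_mem_erase hk
          rw [hw k (Finset.ne_of_mem_erase (Finset.mem_of_mem_erase hk))]
          simp [unitVec, hkj]
      have hvi : (v - unitVec j : Torus d N) i = v i := by simp [unitVec, hij]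
      have hv : ∏ k ∈ Finset.univ.erase i, circleKernel t (v k) = circleKernel t (v j) * R :=
        (Finset.mul_prod_erase _ _ hmem).symm
      rw [show v + unitVec i - unitVec j = v - unitVec j + unitVec i by abel,
        torusKernel_add_unitVec, torusKernel_add_unitVec,
        torusKernel_eq_mul_prod_erase t (v - unitVec j) i, torusKernel_eq_mul_prod_erase t v i,
        hsub _ (fun _ _ => rfl), hv, hvi]
      have h1' := h1 (v j - 1)
      rw [sub_add_cancel] at h1'
      calc _ = |circleKernel t (v i + 1) - circleKernel t (v i)|
            * |circleKernel t (v j) - circleKernel t (v j - 1)| * |R| := by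
              rw [← abs_mul, ← abs_mul, ← abs_neg]; congr 1; ring
        _ ≤ (C * E / m ^ 2) * (C * 1 / m ^ 2) * (C / m) ^ (d - 2) := by
            have h1'' : |circleKernel t (v j) - circleKernel t (v j - 1)| ≤ C * 1 / m ^ 2 :=
              h1'.trans (by gcongr)
            gcongr
            exact h1 _
        _ = _ := by
            obtain ⟨n, rfl⟩ := Nat.exists_eq_add_of_le hd2
            rw [Nat.add_sub_cancel_left, div_pow]
            field_simp
            ring

lemma inv_pow_le_torusKernel (t : ℝ) : 1 / (N : ℝ) ^ d ≤ torusKernel t (0 : Torus d N) := by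
  have hprod : torusKernel t (0 : Torus d N) = circleKernel t (0 : ZMod N) ^ d := by
    simp [torusKernel]
  rw [hprod, ← one_div_pow]
  exact pow_le_pow_left₀ (by positivity) (inv_le_circleKernel t) d

end TorusKernel

/-! ### Renewal inequalities -/

section Renewal

lemma integral_le_sub_of_hasDerivAt_of_le {f F F' : ℝ → ℝ} {T : ℝ} (hT : 0 ≤ T)
    (hf : Continuous f) (hF : ∀ r ∈ Set.Icc 0 T, HasDerivAt F (F' r) r)
    (hF' : ContinuousOn F' (Set.Icc 0 T))
    (hle : ∀ r ∈ Set.Icc 0 T, f r ≤ F' r) : ∫ r in 0..T, f r ≤ F T - F 0 := by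
  have hint : IntervalIntegrable F' volume 0 T := by
    apply ContinuousOn.intervalIntegrable
    rwa [Set.uIcc_of_le hT]
  rw [← intervalIntegral.integral_eq_sub_of_hasDerivAt (f := F) (f' := F')
    (by rwa [Set.uIcc_of_le hT]) hint]
  exact intervalIntegral.integral_mono_on hT (hf.intervalIntegrable _ _) hint hle

/-- Integration by parts against an exponential weight. -/
lemma integral_exp_mul_le {V D : ℝ → ℝ} (hV : ∀ r, HasDerivAt V (-D r) r) (hD : Continuous D)
    {θ T : ℝ} (hVT : 0 ≤ V T) :
    ∫ r in 0..T, Real.exp (θ * r) * D r ≤ V 0 + θ * ∫ r in 0..T, Real.exp (θ * r) * V r := by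
  have hVc : Continuous V := continuous_iff_continuousAt.2 fun r => (hV r).continuousAt
  have hd : ∀ r ∈ Set.uIcc 0 T, HasDerivAt (fun r => Real.exp (θ * r) * V r)
      (θ * (Real.exp (θ * r) * V r) - Real.exp (θ * r) * D r) r := by
    intro r _
    have h1 : HasDerivAt (fun r : ℝ => Real.exp (θ * r)) (Real.exp (θ * r) * (θ * 1)) r :=
      ((hasDerivAt_id r).const_mul θ).exp
    refine (h1.mul (hV r)).congr_deriv ?_
    ring
  have h := intervalIntegral.integral_eq_sub_of_hasDerivAt hd
    (Continuous.intervalIntegrable (by fun_prop) _ _)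
  rw [intervalIntegral.integral_sub (Continuous.intervalIntegrable (by fun_prop) _ _)
    (Continuous.intervalIntegrable (by fun_prop) _ _), intervalIntegral.integral_const_mul,
    mul_zero, Real.exp_zero, one_mul] at h
  have := mul_nonneg (Real.exp_pos (θ * T)).le hVT
  linarith

/-! ### Time integrals of powers of the length scale -/

lemma continuous_diffScale (N : ℕ) : Continuous (diffScale N) := by
  unfold diffScale
  fun_prop

lemma hasDerivAt_neg_mul_exp {a b : ℝ} (hb : b ≠ 0) (r : ℝ) :
    HasDerivAt (fun r => -(a * b) * Real.exp (-(r / b))) (a * Real.exp (-(r / b))) r := by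
  have h := ((((hasDerivAt_id r).div_const b).neg).exp).const_mul (-(a * b))
  refine h.congr_deriv ?_
  simp only [id, Pi.neg_apply]
  field_simp

lemma le_diffScale_of_sq_le {N : ℕ} {r : ℝ} (hr : (N : ℝ) ^ 2 ≤ r) : (N : ℝ) ≤ diffScale N r :=
  le_max_of_le_right (le_min le_rfl (Real.le_sqrt_of_sq_le hr))

/-- Since e < 3, a constant on [0, N²] can be dominated by an exponential with an explicit
antiderivative, which avoids splitting the integrals below. -/
lemma one_le_three_mul_exp {N : ℕ} {r : ℝ} (hN : 0 < N) (hr : r ≤ (N : ℝ) ^ 2) :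
    1 ≤ 3 * Real.exp (-(r / (N : ℝ) ^ 2)) := by
  have hN' : (0 : ℝ) < N := Nat.cast_pos.2 hN
  have h1 : Real.exp (-1) ≤ Real.exp (-(r / (N : ℝ) ^ 2)) := by
    rw [Real.exp_le_exp, neg_le_neg_iff, div_le_one (by positivity)]
    exact hr
  have h2 : Real.exp (-1) * Real.exp 1 = 1 := by rw [← Real.exp_add]; simp
  have h3 := Real.exp_one_lt_d9
  nlinarith [Real.exp_pos (-1)]

/-- Up to time N² the integrand is at most 1, costing 3N² after domination. Later the scale is N,
and the slow exponential of lifetime N ^ (n + 2) contributes N ^ (n + 2) / N ^ n = N². -/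
lemma integral_exp_div_diffScale_le (n : ℕ) {N : ℕ} (hN : 0 < N) {T : ℝ} (hT : 0 ≤ T) :
    ∫ r in 0..T, Real.exp (-(r / (N : ℝ) ^ (n + 2))) / diffScale N r ^ n ≤ 4 * (N : ℝ) ^ 2 := by
  have hN' : (0 : ℝ) < N := Nat.cast_pos.2 hN
  have hm := continuous_diffScale N
  have hm0 : ∀ r, diffScale N r ^ n ≠ 0 := fun r => (pow_pos (diffScale_pos N r) n).ne'
  refine (integral_le_sub_of_hasDerivAt_of_le hT (by fun_prop (disch := assumption))
    (fun r _ => (hasDerivAt_neg_mul_exp (a := 1 / (N : ℝ) ^ n) (b := (N : ℝ) ^ (n + 2))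
      (by positivity) r).add (hasDerivAt_neg_mul_exp (a := 3) (b := (N : ℝ) ^ 2)
      (by positivity) r)) (by fun_prop) ?_).trans ?_
  · intro r hr
    rcases le_total ((N : ℝ) ^ 2) r with h | h
    · calc _ ≤ Real.exp (-(r / (N : ℝ) ^ (n + 2))) / (N : ℝ) ^ n := by
            gcongr
            exact le_diffScale_of_sq_le h
        _ = 1 / (N : ℝ) ^ n * Real.exp (-(r / (N : ℝ) ^ (n + 2))) := by ring
        _ ≤ _ := le_add_of_nonneg_right (by positivity)
    · have hr0 : 0 ≤ r := hr.1
      have h1 : Real.exp (-(r / (N : ℝ) ^ (n + 2))) ≤ 1 :=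
        Real.exp_le_one_iff.2 (by have : 0 ≤ r / (N : ℝ) ^ (n + 2) := by positivity
                                  linarith)
      have h2 : 1 ≤ diffScale N r ^ n := one_le_pow₀ (one_le_diffScale N r)
      calc _ ≤ 1 := by rw [div_le_one (by positivity)]; linarith
        _ ≤ 3 * Real.exp (-(r / (N : ℝ) ^ 2)) := one_le_three_mul_exp hN h
        _ ≤ _ := le_add_of_nonneg_left (by positivity)
  · have h1 := Real.exp_pos (-(T / (N : ℝ) ^ (n + 2)))
    have h2 := Real.exp_pos (-(T / (N : ℝ) ^ 2))
    have h3 : 1 / (N : ℝ) ^ n * (N : ℝ) ^ (n + 2) = (N : ℝ) ^ 2 := by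
      rw [pow_add]; field_simp
    simp only [Pi.add_apply, h3, zero_div, neg_zero, Real.exp_zero]
    nlinarith [pow_pos hN' 2]

/-- The extra power gains a factor N. Up to time N² the integrand is at most 2/(1 + r); by AM-GM
this is at most 1/N + N/(1 + r)², whose parts cost 3N (after domination) and N. The late tail costs
another N. -/
lemma integral_exp_div_diffScale_succ_le {n : ℕ} (hn : 1 ≤ n) {N : ℕ} (hN : 0 < N) {T : ℝ}
    (hT : 0 ≤ T) :
    ∫ r in 0..T, Real.exp (-(r / (N : ℝ) ^ (n + 2))) / diffScale N r ^ (n + 1) ≤ 5 * N := by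
  have hN' : (0 : ℝ) < N := Nat.cast_pos.2 hN
  have hm := continuous_diffScale N
  have hm0 : ∀ r, diffScale N r ^ (n + 1) ≠ 0 := fun r => (pow_pos (diffScale_pos N r) _).ne'
  have hinv : ∀ r ∈ Set.Icc 0 T, HasDerivAt (fun r : ℝ => -N * (1 + r)⁻¹) (N / (1 + r) ^ 2) r := by
    intro r hr
    have h1 : (1 + r) ≠ 0 := by linarith [hr.1]
    have h := (((hasDerivAt_id r).const_add 1).inv h1).const_mul (-(N : ℝ))
    refine h.congr_deriv ?_
    simp only [id]
    ring
  refine (integral_le_sub_of_hasDerivAt_of_le hT (by fun_prop (disch := assumption))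
    (fun r hr => ((hasDerivAt_neg_mul_exp (a := 1 / (N : ℝ) ^ (n + 1)) (b := (N : ℝ) ^ (n + 2))
      (by positivity) r).add (hasDerivAt_neg_mul_exp (a := 3 / N) (b := (N : ℝ) ^ 2)
      (by positivity) r)).add (hinv r hr)) ?_ ?_).trans ?_
  · refine ContinuousOn.add (by fun_prop) (ContinuousOn.div (by fun_prop) (by fun_prop) ?_)
    intro r hr
    have : 0 < 1 + r := by linarith [hr.1]
    positivity
  · intro r hr
    have hr0 : 0 ≤ r := hr.1
    rcases le_total ((N : ℝ) ^ 2) r with h | h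
    · calc _ ≤ Real.exp (-(r / (N : ℝ) ^ (n + 2))) / (N : ℝ) ^ (n + 1) := by
            gcongr
            exact le_diffScale_of_sq_le h
        _ = 1 / (N : ℝ) ^ (n + 1) * Real.exp (-(r / (N : ℝ) ^ (n + 2))) := by ring
        _ ≤ _ := by
            rw [add_assoc]
            exact le_add_of_nonneg_right (by positivity)
    · have h1 : Real.exp (-(r / (N : ℝ) ^ (n + 2))) ≤ 1 :=
        Real.exp_le_one_iff.2 (by have : 0 ≤ r / (N : ℝ) ^ (n + 2) := by positivity
                                  linarith)
      have hm1 := one_le_diffScale N r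
      have hmr : r ≤ diffScale N r ^ 2 := by
        have : Real.sqrt r ≤ diffScale N r :=
          le_max_of_le_right (le_min ((Real.sqrt_le_left hN'.le).2 h) le_rfl)
        calc r = Real.sqrt r ^ 2 := (Real.sq_sqrt hr0).symm
          _ ≤ _ := by gcongr
      have h2 : (1 + r) / 2 ≤ diffScale N r ^ (n + 1) := by
        have : diffScale N r ^ 2 ≤ diffScale N r ^ (n + 1) := pow_le_pow_right₀ hm1 (by omega)
        nlinarith
      have h3 := one_le_three_mul_exp hN h
      calc _ ≤ 1 / ((1 + r) / 2) := by gcongr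
        _ ≤ 1 / N + N / (1 + r) ^ 2 := by
            have : 0 ≤ (1 / Real.sqrt N - Real.sqrt N / (1 + r)) ^ 2 := sq_nonneg _
            have hs : Real.sqrt N ^ 2 = N := Real.sq_sqrt hN'.le
            have hs0 : 0 < Real.sqrt N := Real.sqrt_pos.2 hN'
            have he : (1 / Real.sqrt N - Real.sqrt N / (1 + r)) ^ 2
                = 1 / Real.sqrt N ^ 2 + Real.sqrt N ^ 2 / (1 + r) ^ 2 - 1 / ((1 + r) / 2) := by
              field_simp
              ring
            rw [he, hs] at this
            linarith
        _ ≤ 3 / N * Real.exp (-(r / (N : ℝ) ^ 2)) + N / (1 + r) ^ 2 := by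
            have : 1 / (N : ℝ) * 1 ≤ 1 / N * (3 * Real.exp (-(r / (N : ℝ) ^ 2))) := by gcongr
            have h4 : 1 / (N : ℝ) * (3 * Real.exp (-(r / (N : ℝ) ^ 2)))
              = 3 / N * Real.exp (-(r / (N : ℝ) ^ 2)) := by ring
            linarith
        _ ≤ _ := by
            rw [add_assoc]
            exact le_add_of_nonneg_left (by positivity)
  · have h1 := Real.exp_pos (-(T / (N : ℝ) ^ (n + 2)))
    have h2 := Real.exp_pos (-(T / (N : ℝ) ^ 2))
    have h3 : 1 / (N : ℝ) ^ (n + 1) * (N : ℝ) ^ (n + 2) = N := by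
      rw [pow_succ _ (n + 1)]; field_simp
    have h4 : 3 / (N : ℝ) * (N : ℝ) ^ 2 = 3 * N := by field_simp
    have h5 : 0 ≤ (1 + T)⁻¹ := by positivity
    simp only [Pi.add_apply, h3, h4, zero_div, neg_zero, Real.exp_zero, add_zero, inv_one]
    nlinarith

/-- The mass of a convolution on `[0, T]` is at most the product of the masses. -/
lemma integral_convolution_le {g k : ℝ → ℝ} (hg : Continuous g) (hk : Continuous k)
    (g0 : ∀ t, 0 ≤ t → 0 ≤ g t) (k0 : ∀ t, 0 ≤ t → 0 ≤ k t) {T : ℝ} (hT : 0 ≤ T) :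
    ∫ t in 0..T, ∫ s in 0..t, g s * k (t - s) ≤ (∫ t in 0..T, g t) * ∫ t in 0..T, k t := by
  -- Both functions are cut off at `T`, so that the product formula for convolutions on the
  -- half-line applies. The cutoff does not affect the convolution on [0, T].
  have hint : ∀ u : ℝ → ℝ, Continuous u →
      IntegrableOn ((Set.Iic T).indicator u) (Set.Ioi 0) := by
    intro u hu
    rw [IntegrableOn, integrable_indicator_iff measurableSet_Iic, IntegrableOn,
      Measure.restrict_restrict measurableSet_Iic, Set.inter_comm, Set.Ioi_inter_Iic]
    exact (hu.integrableOn_Icc (a := 0) (b := T)).mono_set Set.Ioc_subset_Icc_self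
  have hval : ∀ u : ℝ → ℝ, ∫ x in Set.Ioi 0, (Set.Iic T).indicator u x = ∫ x in 0..T, u x := by
    intro u
    rw [setIntegral_indicator measurableSet_Iic, Set.Ioi_inter_Iic,
      intervalIntegral.integral_of_le hT]
  have h := integral_posConvolution (μ := volume) (ν := volume) (hint g hg) (hint k hk)
    (ContinuousLinearMap.mul ℝ ℝ)
  have hI := integrable_posConvolution (μ := volume) (ν := volume) (hint g hg) (hint k hk)
    (ContinuousLinearMap.mul ℝ ℝ)
  simp only [ContinuousLinearMap.mul_apply', hval] at h
  rw [← h, intervalIntegral.integral_of_le hT]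
  have hI' : IntegrableOn (fun x => ∫ t in 0..x, (Set.Iic T).indicator g t
      * (Set.Iic T).indicator k (x - t)) (Set.Ioi 0) := by
    rw [← integrable_indicator_iff measurableSet_Ioi]
    exact hI
  have hnn : ∀ (u : ℝ → ℝ), (∀ t, 0 ≤ t → 0 ≤ u t) → ∀ t, 0 ≤ t →
      0 ≤ (Set.Iic T).indicator u t := by
    intro u hu t ht
    by_cases h : t ∈ Set.Iic T
    · rw [Set.indicator_of_mem h]; exact hu t ht
    · rw [Set.indicator_of_notMem h]
  calc ∫ t in Set.Ioc 0 T, ∫ s in 0..t, g s * k (t - s)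
      = ∫ x in Set.Ioc 0 T, ∫ t in 0..x, (Set.Iic T).indicator g t
        * (Set.Iic T).indicator k (x - t) := by
        refine setIntegral_congr_fun measurableSet_Ioc fun x hx => ?_
        refine intervalIntegral.integral_congr fun t ht => ?_
        rw [Set.uIcc_of_le hx.1.le] at ht
        have h1 : t ∈ Set.Iic T := ht.2.trans hx.2
        have h2 : x - t ∈ Set.Iic T := by
          have := ht.1
          have := hx.2
          simp only [Set.mem_Iic]
          linarith
        simp only [Set.indicator_of_mem h1, Set.indicator_of_mem h2]
    _ ≤ _ := by
        refine setIntegral_mono_set hI' ?_ (Set.Ioc_subset_Ioi_self.eventuallyLE)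
        refine (ae_restrict_mem measurableSet_Ioi).mono fun x hx => ?_
        have hx0 : (0 : ℝ) ≤ x := le_of_lt hx
        refine intervalIntegral.integral_nonneg hx0 fun t ht => ?_
        exact mul_nonneg (hnn g g0 t ht.1) (hnn k k0 _ (by linarith [ht.2]))

variable {E : Type*} [Fintype E] {g h : ℝ → E → ℝ} {K : ℝ → E → E → ℝ}

lemma continuous_integral_convolution {g k : ℝ → ℝ} (hg : Continuous g) (hk : Continuous k) :
    Continuous fun t => ∫ s in 0..t, g s * k (t - s) := by
  exact intervalIntegral.continuous_parametric_intervalIntegral_of_continuous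
    (f := fun t s => g s * k (t - s)) (by fun_prop) continuous_id

/-- Total mass bound for a renewal inequality whose kernel has mass at most `5/8`. -/
lemma renewal_mass_le (hg : ∀ e, Continuous fun t => g t e) (hh : ∀ e, Continuous fun t => h t e)
    (hK : ∀ e f, Continuous fun t => K t e f)
    (g0 : ∀ t, 0 ≤ t → ∀ e, 0 ≤ g t e) (K0 : ∀ t, 0 ≤ t → ∀ e f, 0 ≤ K t e f)
    (hren : ∀ t, 0 ≤ t → ∀ f, g t f ≤ h t f + ∫ s in 0..t, ∑ e, g s e * K (t - s) e f)
    (hKout : ∀ T, 0 ≤ T → ∀ e, ∫ r in 0..T, ∑ f, K r e f ≤ 5 / 8)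
    {C : ℝ} {T : ℝ} (hT : 0 ≤ T) (hmass : ∫ t in 0..T, ∑ f, h t f ≤ C) :
    ∫ t in 0..T, ∑ f, g t f ≤ 8 / 3 * C := by
  have hconv : ∀ e, Continuous fun t => ∫ s in 0..t, g s e * ∑ f, K (t - s) e f := fun e =>
    continuous_integral_convolution (g := fun s => g s e) (k := fun r => ∑ f, K r e f) (hg e)
      (by fun_prop)
  have h1 : ∀ t ∈ Set.Icc 0 T, ∑ f, g t f
      ≤ ∑ f, h t f + ∑ e, ∫ s in 0..t, g s e * ∑ f, K (t - s) e f := by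
    intro t ht
    refine (Finset.sum_le_sum fun f _ => hren t ht.1 f).trans (le_of_eq ?_)
    rw [Finset.sum_add_distrib, ← intervalIntegral.integral_finsetSum,
      ← intervalIntegral.integral_finsetSum]
    · congr 1
      refine intervalIntegral.integral_congr fun s _ => ?_
      simp only [Finset.mul_sum]
      exact Finset.sum_comm
    · intro e _
      have := hg e
      have := hK e
      exact Continuous.intervalIntegrable (by fun_prop) _ _
    · intro f _
      exact Continuous.intervalIntegrable (by fun_prop) _ _
  have h2 := intervalIntegral.integral_mono_on (μ := volume) hT
    (Continuous.intervalIntegrable (by fun_prop) _ _)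
    (Continuous.intervalIntegrable (by fun_prop) _ _) h1
  rw [intervalIntegral.integral_add (Continuous.intervalIntegrable (by fun_prop) _ _)
    (Continuous.intervalIntegrable (by fun_prop) _ _),
    intervalIntegral.integral_finsetSum fun e _ => (hconv e).intervalIntegrable _ _] at h2
  have h3 : ∑ e, ∫ t in 0..T, ∫ s in 0..t, g s e * ∑ f, K (t - s) e f
      ≤ 5 / 8 * ∫ t in 0..T, ∑ f, g t f := by
    rw [intervalIntegral.integral_finsetSum fun e _ => (hg e).intervalIntegrable _ _,
      Finset.mul_sum]
    refine Finset.sum_le_sum fun e _ => ?_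
    refine (integral_convolution_le (g := fun s => g s e) (k := fun r => ∑ f, K r e f) (hg e)
      (by fun_prop) (fun t ht => g0 t ht e)
      (fun t ht => Finset.sum_nonneg fun f _ => K0 t ht e f) hT).trans ?_
    rw [mul_comm]
    refine mul_le_mul_of_nonneg_right (hKout T hT e) ?_
    exact intervalIntegral.integral_nonneg hT fun t ht => g0 t ht.1 e
  -- The total mass I satisfies I ≤ C + 5/8 * I, and 1 / (1 - 5/8) = 8/3.
  linarith

/-- Pointwise bound for a renewal inequality whose kernel has mass at most `5/8`, when the kernel
decays at least as fast as the inverse of the weight. -/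
lemma renewal_bound (hg : ∀ e, Continuous fun t => g t e) (hh : ∀ e, Continuous fun t => h t e)
    (hK : ∀ e f, Continuous fun t => K t e f)
    (g0 : ∀ t, 0 ≤ t → ∀ e, 0 ≤ g t e) (K0 : ∀ t, 0 ≤ t → ∀ e f, 0 ≤ K t e f)
    (hren : ∀ t, 0 ≤ t → ∀ f, g t f ≤ h t f + ∫ s in 0..t, ∑ e, g s e * K (t - s) e f)
    (hKout : ∀ T, 0 ≤ T → ∀ e, ∫ r in 0..T, ∑ f, K r e f ≤ 5 / 8)
    (hKin : ∀ T, 0 ≤ T → ∀ f, ∫ r in 0..T, ∑ e, K r e f ≤ 5 / 8)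
    {w : ℝ → ℝ} (hw : Continuous w) (w0 : ∀ t, 0 < w t) {δ C₁ C₂ C₃ : ℝ} (hδ0 : 0 ≤ δ)
    (hδ1 : δ ≤ 1) (hC₂ : 0 ≤ C₂)
    (hwδ : ∀ s t, 0 ≤ s → (1 - δ) * t ≤ s → s ≤ t → w t ≤ 6 / 5 * w s)
    (hmass : ∀ T, 0 ≤ T → ∫ t in 0..T, ∑ f, h t f ≤ C₃)
    (hh₁ : ∀ t, 0 ≤ t → ∀ f, w t * h t f ≤ C₁)
    (hK₂ : ∀ r t, 0 ≤ t → δ * t ≤ r → ∀ e f, w t * K r e f ≤ C₂)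
    {T : ℝ} (hT : 0 ≤ T) (f : E) : w T * g T f ≤ 4 * (C₁ + C₂ * (8 / 3 * C₃)) := by
  -- The weighted solution is maximized over [0, T] and over all indices. The renewal inequality is
  -- used only at the maximizer, where the short-lag part can be compared with `M` itself.
  have hmax : ∀ f, ∃ t ∈ Set.Icc 0 T, ∀ s ∈ Set.Icc 0 T, w s * g s f ≤ w t * g t f := fun f => by
    have := hg f
    exact isCompact_Icc.exists_isMaxOn (Set.nonempty_Icc.2 hT)
      (f := fun s => w s * g s f) (by fun_prop)
  choose τ hτ hτmax using hmax
  have : Nonempty E := ⟨f⟩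
  obtain ⟨f₀, hf₀⟩ := Finite.exists_max fun f => w (τ f) * g (τ f) f
  set M := w (τ f₀) * g (τ f₀) f₀ with hM
  have hMle : ∀ s ∈ Set.Icc 0 T, ∀ e, w s * g s e ≤ M := fun s hs e =>
    (hτmax e s hs).trans (hf₀ e)
  have hM0 : 0 ≤ M := mul_nonneg (w0 _).le (g0 _ (hτ f₀).1 _)
  refine (hMle T ⟨hT, le_rfl⟩ f).trans ?_
  set t := τ f₀
  obtain ⟨ht0, htT⟩ : 0 ≤ t ∧ t ≤ T := hτ f₀
  have hu0 : 0 ≤ (1 - δ) * t := mul_nonneg (by linarith) ht0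
  have hut : (1 - δ) * t ≤ t := mul_le_of_le_one_left ht0 (by linarith)
  have hcont : Continuous fun s => ∑ e, g s e * K (t - s) e f₀ := by
    have := fun e => hK e f₀
    fun_prop
  -- Long lags, t - s ≥ δt: the weight at time `t` is absorbed by the kernel, leaving the total mass
  -- of `g`.
  have hfirst : w t * ∫ s in 0..(1 - δ) * t, ∑ e, g s e * K (t - s) e f₀ ≤ C₂ * (8 / 3 * C₃) := by
    rw [← intervalIntegral.integral_const_mul]
    calc _ ≤ ∫ s in 0..(1 - δ) * t, C₂ * ∑ e, g s e := by
          refine intervalIntegral.integral_mono_on hu0 (Continuous.intervalIntegrable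
            (by fun_prop) _ _) (Continuous.intervalIntegrable (by fun_prop) _ _) fun s hs => ?_
          rw [Finset.mul_sum, Finset.mul_sum]
          refine Finset.sum_le_sum fun e _ => ?_
          have h1 := hK₂ (t - s) t ht0 (by linarith [hs.2]) e f₀
          have h2 := mul_le_mul_of_nonneg_left h1 (g0 s hs.1 e)
          linarith
      _ = C₂ * ∫ s in 0..(1 - δ) * t, ∑ e, g s e := intervalIntegral.integral_const_mul _ _
      _ ≤ _ := by
          refine mul_le_mul_of_nonneg_left ?_ hC₂
          exact renewal_mass_le hg hh hK g0 K0 hren hKout hu0 (hmass _ hu0)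
  -- Short lags: the weight moves from `t` to `s` at cost 6/5, and the kernel mass 5/8 yields the
  -- factor 3/4. Absorbing it in `M` accounts for the final factor 4.
  have hsecond : w t * ∫ s in (1 - δ) * t..t, ∑ e, g s e * K (t - s) e f₀ ≤ 3 / 4 * M := by
    rw [← intervalIntegral.integral_const_mul]
    have hKc : Continuous fun r => ∑ e, K r e f₀ := by
      have := fun e => hK e f₀
      fun_prop
    calc _ ≤ ∫ s in (1 - δ) * t..t, 6 / 5 * M * ∑ e, K (t - s) e f₀ := by
          refine intervalIntegral.integral_mono_on hut (Continuous.intervalIntegrable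
            (by fun_prop) _ _) (Continuous.intervalIntegrable (by fun_prop) _ _) fun s hs => ?_
          rw [Finset.mul_sum, Finset.mul_sum]
          refine Finset.sum_le_sum fun e _ => ?_
          have hs0 := hu0.trans hs.1
          have h1 := hMle s ⟨hs0, hs.2.trans htT⟩ e
          have h2 := hwδ s t hs0 hs.1 hs.2
          have h3 : w t * g s e ≤ 6 / 5 * M := by
            have := mul_le_mul_of_nonneg_right h2 (g0 s hs0 e)
            linarith
          have h4 := mul_le_mul_of_nonneg_right h3 (K0 (t - s) (by linarith [hs.2]) e f₀)
          linarith
      _ = 6 / 5 * M * ∫ s in (1 - δ) * t..t, ∑ e, K (t - s) e f₀ :=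
          intervalIntegral.integral_const_mul _ _
      _ = 6 / 5 * M * ∫ r in 0..δ * t, ∑ e, K r e f₀ := by
          rw [intervalIntegral.integral_comp_sub_left (fun r => ∑ e, K r e f₀), sub_self,
            show t - (1 - δ) * t = δ * t by ring]
      _ ≤ 6 / 5 * M * (5 / 8) :=
          mul_le_mul_of_nonneg_left (hKin _ (mul_nonneg hδ0 ht0) f₀) (by positivity)
      _ = _ := by ring
  have hmain := mul_le_mul_of_nonneg_left (hren t ht0 f₀) (w0 t).le
  rw [← hM, ← intervalIntegral.integral_add_adjacent_intervals
    (hcont.intervalIntegrable 0 ((1 - δ) * t)) (hcont.intervalIntegrable _ _),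
    mul_add, mul_add] at hmain
  have := hh₁ t ht0 f₀
  linarith

end Renewal

/-! ### Second moments of the averaging process -/

section Exponential

variable {E : Type*} [NormedAddCommGroup E] [NormedSpace ℝ E]

lemma hasDerivAt_sum_smul {ι : Type*} [Fintype ι] {a : ℝ → ι → ℝ} {a' : ι → ℝ} {s : ℝ} (v : ι → E)
    (h : ∀ z, HasDerivAt (fun s => a s z) (a' z) s) :
    HasDerivAt (fun s => ∑ z, a s z • v z) (∑ z, a' z • v z) s :=
  HasDerivAt.fun_sum fun z _ => (h z).smul_const _

lemma opExp_zero_smul_apply (A : E →L[ℝ] E) (v : E) : opExp ((0 : ℝ) • A) v = v := by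
  simp [opExp]

lemma hasDerivAt_opExp_smul_apply [CompleteSpace E] (A : E →L[ℝ] E) (l : E →L[ℝ] ℝ) {u : ℝ → E}
    {u' : E} {s : ℝ} (hu : HasDerivAt u u' s) :
    HasDerivAt (fun s => l (opExp (s • A) (u s))) (l (opExp (s • A) (A (u s) + u'))) s := by
  have h := (hasDerivAt_exp_smul_const A s).clm_apply hu
  refine (l.hasFDerivAt.comp_hasDerivAt s h).congr_deriv ?_
  rw [opExp, map_add (NormedSpace.exp (s • A)), mul_apply_eq_comp]

end Exponential

section Duality

variable {d N : ℕ} [NeZero N]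

/-- The mass at a given site, as a continuous function on the space of states. -/
def massAt (z : Torus d N) : C(Prob d N, ℝ) where
  toFun η := η.1 z
  continuous_toFun := (continuous_apply z).comp continuous_subtype_val

/-- The integral of a fixed function `a` against the state. -/
def pairing (a : Torus d N → ℝ) : C(Prob d N, ℝ) := ∑ z, a z • massAt z

/-- The increment of the state along an edge. -/
def gradMass (e : Torus d N × Fin d) : C(Prob d N, ℝ) :=
  massAt (e.1 + unitVec e.2) - massAt e.1

lemma pairing_apply (a : Torus d N → ℝ) (η : Prob d N) : pairing a η = ∑ z, a z * η.1 z := by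
  simp [pairing, massAt, ContinuousMap.sum_apply]

lemma gradMass_apply (e : Torus d N × Fin d) (η : Prob d N) : gradMass e η = grad η.1 e := rfl

/-- The update transports the signed mass (η y - η x) / 2 from `y` to `x`. -/
lemma pairing_avgUpdate {x y : Torus d N} (h : (torusGraph d N).Adj x y) (a : Torus d N → ℝ)
    (η : Prob d N) : pairing a (avgUpdate h η)
      = pairing a η - 1 / 2 * ((η.1 y - η.1 x) * (a y - a x)) := by
  classical
  have hxy := h.ne
  have hpt : ∀ z, a z * avgFun x y η.1 z = a z * η.1 z
      + ((if z = x then a z * ((η.1 y - η.1 x) / 2) else 0)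
        + (if z = y then a z * ((η.1 x - η.1 y) / 2) else 0)) := by
    intro z
    unfold avgFun
    by_cases hzx : z = x
    · subst hzx
      simp [hxy]
      ring
    · by_cases hzy : z = y
      · subst hzy
        simp [hzx]
        ring
      · simp [hzx, hzy]
  simp only [pairing_apply, avgUpdate, ContinuousMap.coe_mk, hpt, Finset.sum_add_distrib,
    Finset.sum_ite_eq', Finset.mem_univ, if_true]
  ring

-- The prefactor 1/2 compensates for counting each edge in both orientations.
open Classical in
lemma half_sum_adj (hN : 3 ≤ N) (F : Torus d N → Torus d N → ℝ) (hF : ∀ x y, F x y = F y x) :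
    (1 / 2 : ℝ) * ∑ x, ∑ y, (if (torusGraph d N).Adj x y then F x y else 0)
      = ∑ e : Torus d N × Fin d, F e.1 (e.1 + unitVec e.2) := by
  have h : ∀ i : Fin d, ∑ x, F x (x - unitVec i) = ∑ x, F x (x + unitVec i) := by
    intro i
    rw [← sum_add_unitVec (fun x => F x (x - unitVec i)) (unitVec i)]
    simp only [add_sub_cancel_right]
    exact Finset.sum_congr rfl fun x _ => hF _ _
  simp only [sum_adj hN]
  rw [Finset.sum_comm, Fintype.sum_prod_type_right]
  simp only [Finset.sum_add_distrib, h]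
  ring

-- The part linear in the jump of the pairing sums to the heat drift. The squared jumps give the
-- remaining term, which involves the state only through its squared increments; this is what closes
-- the second-moment equation.
open Classical in
lemma generator_pairing_sq (hN : 3 ≤ N) (a : Torus d N → ℝ) :
    generator d N (pairing a * pairing a) = (2 : ℝ) • (pairing a * pairing (laplacian a))
      + ∑ e, (1 / 4 * grad a e ^ 2) • (gradMass e * gradMass e) := by
  ext η
  rw [generator_apply]
  set u := pairing a η with hu
  set F : Torus d N → Torus d N → ℝ := fun x y => -u * ((η.1 y - η.1 x) * (a y - a x))
    + 1 / 4 * ((a y - a x) ^ 2 * (η.1 y - η.1 x) ^ 2) with hF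
  have hdite : ∀ x y, (if h : (torusGraph d N).Adj x y then
      (pairing a * pairing a) (avgUpdate h η) - (pairing a * pairing a) η else 0)
      = if (torusGraph d N).Adj x y then F x y else 0 := by
    intro x y
    split_ifs with h
    · simp only [ContinuousMap.mul_apply, pairing_avgUpdate, ← hu, hF]
      ring
    · rfl
  simp only [hdite]
  rw [half_sum_adj hN F fun x y => by simp only [hF]; ring]
  have hsum := sum_grad_mul_grad η.1 a
  have hp : pairing (laplacian a) η = ∑ x, η.1 x * laplacian a x := by
    rw [pairing_apply]
    exact Finset.sum_congr rfl fun x _ => mul_comm _ _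
  simp only [hF, ContinuousMap.add_apply, ContinuousMap.smul_apply, ContinuousMap.mul_apply,
    ContinuousMap.sum_apply, smul_eq_mul, gradMass_apply, Finset.sum_add_distrib, ← Finset.mul_sum,
    hp, ← hu]
  have h1 : ∑ e : Torus d N × Fin d, (η.1 (e.1 + unitVec e.2) - η.1 e.1)
      * (a (e.1 + unitVec e.2) - a e.1) = ∑ e, grad η.1 e * grad a e := rfl
  rw [h1, hsum]
  have h2 : ∀ e : Torus d N × Fin d, 1 / 4 * grad a e ^ 2 * (grad η.1 e * grad η.1 e)
      = 1 / 4 * ((a (e.1 + unitVec e.2) - a e.1) ^ 2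
        * (η.1 (e.1 + unitVec e.2) - η.1 e.1) ^ 2) := fun e => by simp only [grad]; ring
  simp only [h2, ← Finset.mul_sum]
  ring

lemma hasDerivAt_pairing {a : ℝ → Torus d N → ℝ} {a' : Torus d N → ℝ} {s : ℝ}
    (h : ∀ z, HasDerivAt (fun s => a s z) (a' z) s) :
    HasDerivAt (fun s => pairing (a s)) (pairing a') s := by
  exact hasDerivAt_sum_smul massAt h

lemma pairing_neg (a : Torus d N → ℝ) : pairing (-a) = -pairing a := by
  simp [pairing]

lemma pairing_edgeFlow_zero (f : Torus d N × Fin d) : pairing (edgeFlow 0 f) = gradMass f := by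
  ext η
  rw [pairing_apply, gradMass_apply, ← sum_mul_edgeFlow_zero]
  exact Finset.sum_congr rfl fun z _ => mul_comm _ _

lemma pairing_vertex (a : Torus d N → ℝ) (x : Torus d N) :
    pairing a (stdSimplex.vertex (S := ℝ) x) = a x := by
  rw [pairing_apply]
  simp [Pi.single_apply]

variable (d N) in
/-- Evaluation at the unit mass at the origin. -/
def evalVertex : C(Prob d N, ℝ) →L[ℝ] ℝ :=
  ContinuousMap.evalCLM ℝ (stdSimplex.vertex (S := ℝ) (0 : Torus d N))

variable (d N) in
/-- The expectation of `f` at time `t`, from the unit mass at the origin. -/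
def meanAt (t : ℝ) (f : C(Prob d N, ℝ)) : ℝ := evalVertex d N (opExp (t • generator d N) f)

/-- The mean squared increment of the averaging process along an edge. -/
def meanSqGrad (t : ℝ) (e : Torus d N × Fin d) : ℝ := meanAt d N t (gradMass e * gradMass e)

lemma hasDerivAt_meanAt {u : ℝ → C(Prob d N, ℝ)} {u' : C(Prob d N, ℝ)} {s : ℝ}
    (hu : HasDerivAt u u' s) :
    HasDerivAt (fun s => meanAt d N s (u s)) (meanAt d N s (generator d N (u s) + u')) s :=
  hasDerivAt_opExp_smul_apply (generator d N) (evalVertex d N) hu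

lemma continuous_meanAt (f : C(Prob d N, ℝ)) : Continuous fun t => meanAt d N t f :=
  continuous_iff_continuousAt.2 fun t => (hasDerivAt_meanAt (hasDerivAt_const t f)).continuousAt

lemma meanAt_zero (f : C(Prob d N, ℝ)) : meanAt d N 0 f = evalVertex d N f :=
  congrArg (evalVertex d N) (opExp_zero_smul_apply (generator d N) f)

lemma meanAt_sum_smul {ι : Type*} [Fintype ι] (t : ℝ) (c : ι → ℝ) (f : ι → C(Prob d N, ℝ)) :
    meanAt d N t (∑ i, c i • f i) = ∑ i, c i * meanAt d N t (f i) := by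
  simp only [meanAt, map_sum, map_smul, smul_eq_mul]

/-- With the test function solving the heat equation backwards in `s`, its time derivative cancels
the drift and only the squared-jump term is left. -/
lemma hasDerivAt_meanAt_edgeFlow (hN : 3 ≤ N) (t s : ℝ) (f : Torus d N × Fin d) :
    HasDerivAt (fun s => meanAt d N s (pairing (edgeFlow (t - s) f) * pairing (edgeFlow (t - s) f)))
      (∑ e, meanSqGrad s e * (1 / 4 * grad (edgeFlow (t - s) f) e ^ 2)) s := by
  have h1 : HasDerivAt (fun s => pairing (edgeFlow (t - s) f))
      (-pairing (laplacian (edgeFlow (t - s) f))) s := by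
    rw [← pairing_neg]
    refine hasDerivAt_pairing fun z => ?_
    refine ((hasDerivAt_edgeFlow (t - s) f z).comp s
      ((hasDerivAt_id s).const_sub t)).congr_deriv ?_
    simp
  refine (hasDerivAt_meanAt (h1.mul h1)).congr_deriv ?_
  have h2 : generator d N (pairing (edgeFlow (t - s) f) * pairing (edgeFlow (t - s) f))
        + (-pairing (laplacian (edgeFlow (t - s) f)) * pairing (edgeFlow (t - s) f)
          + pairing (edgeFlow (t - s) f) * -pairing (laplacian (edgeFlow (t - s) f)))
      = ∑ e, (1 / 4 * grad (edgeFlow (t - s) f) e ^ 2) • (gradMass e * gradMass e) := by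
    rw [generator_pairing_sq hN, two_smul]
    ring
  refine (congrArg (meanAt d N s) h2).trans ?_
  rw [meanAt_sum_smul]
  exact Finset.sum_congr rfl fun e _ => mul_comm _ _

lemma continuous_meanSqGrad (e : Torus d N × Fin d) : Continuous fun t => meanSqGrad t e :=
  continuous_meanAt _

lemma continuous_grad_edgeFlow (e f : Torus d N × Fin d) :
    Continuous fun r => grad (edgeFlow r f) e := by
  have h : ∀ z, Continuous fun r => edgeFlow r f z := fun z =>
    continuous_iff_continuousAt.2 fun r => (hasDerivAt_edgeFlow r f z).continuousAt
  exact (h _).sub (h _)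

/-- The renewal equation for the mean squared increments. -/
lemma meanSqGrad_eq (hN : 3 ≤ N) (t : ℝ) (f : Torus d N × Fin d) :
    meanSqGrad t f = grad (torusKernel t) f ^ 2
      + ∫ s in 0..t, ∑ e, meanSqGrad s e * (1 / 4 * grad (edgeFlow (t - s) f) e ^ 2) := by
  rw [intervalIntegral.integral_eq_sub_of_hasDerivAt
    (fun s _ => hasDerivAt_meanAt_edgeFlow hN t s f)
    ((continuous_finsetSum _ fun e _ => (continuous_meanSqGrad e).mul (continuous_const.mul
      (((continuous_grad_edgeFlow e f).comp (continuous_const.sub continuous_id)).pow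
        2))).intervalIntegrable _ _)]
  have h0 : meanAt d N 0 (pairing (edgeFlow (t - 0) f) * pairing (edgeFlow (t - 0) f))
      = grad (torusKernel t) f ^ 2 := by
    rw [meanAt_zero, sub_zero, pow_two, ← edgeFlow_apply_zero, ← pairing_vertex (edgeFlow t f) 0]
    rfl
  rw [h0, sub_self, pairing_edgeFlow_zero, meanSqGrad]
  ring

/-- The Markov property from time 0, averaged by the tower property, with the initial state almost
surely constant. -/
lemma IsAveragingProcess.integral_eq {Ω : Type*} [MeasurableSpace Ω] {P : Measure Ω}
    [IsProbabilityMeasure P] {ξ : Prob d N} {η : ℝ≥0 → Ω → Prob d N}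
    (h : IsAveragingProcess P ξ η) (t : ℝ≥0) (f : C(Prob d N, ℝ)) :
    ∫ ω, f (η t ω) ∂P = semigroup d N t f ξ := by
  have hle : history η 0 ≤ (inferInstance : MeasurableSpace Ω) :=
    iSup_le fun r => (h.measurable r).comap_le
  have h1 := h.markov 0 t f
  rw [zero_add] at h1
  rw [← integral_condExp hle, integral_congr_ae h1,
    integral_congr_ae (g := fun _ => semigroup d N t f ξ)
      (h.initial.mono fun ω hω => by simp only [hω])]
  simp

lemma IsAveragingProcess.integral_sq_eq {Ω : Type*} [MeasurableSpace Ω] {P : Measure Ω}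
    [IsProbabilityMeasure P] {η : ℝ≥0 → Ω → Prob d N}
    (h : IsAveragingProcess P (stdSimplex.vertex (S := ℝ) (0 : Torus d N)) η) (t : ℝ≥0)
    (e : Torus d N × Fin d) :
    ∫ ω, (η t ω (e.1 + unitVec e.2) - η t ω e.1) ^ 2 ∂P = meanSqGrad t e := by
  refine Eq.trans ?_ (h.integral_eq t (gradMass e * gradMass e))
  refine integral_congr_ae (Eventually.of_forall fun ω => ?_)
  simp only [pow_two]
  rfl

/-! ### Comparison with the spectral gap of the torus -/

lemma charRe_one (hN : 2 ≤ N) : 1 - charRe (1 : ZMod N) = circleGap N := by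
  have : Fact (1 < N) := ⟨by omega⟩
  rw [one_sub_charRe, halfSin, circleGap, ZMod.val_one, Nat.cast_one, mul_one]

lemma circleGap_ge (hN : 2 ≤ N) : 8 / (N : ℝ) ^ 2 ≤ circleGap N := by
  have h := two_mul_le_sin_pi_mul (n := N) (k := 1) (by omega) (by omega)
  rw [Nat.cast_one, mul_one, mul_one] at h
  have h2 := pow_le_pow_left₀ (by positivity) h 2
  rw [div_pow] at h2
  rw [circleGap]
  calc 8 / (N : ℝ) ^ 2 = 2 * (2 ^ 2 / (N : ℝ) ^ 2) := by ring
    _ ≤ _ := by gcongr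

lemma circleGap_le (N : ℕ) : circleGap N ≤ 32 / (N : ℝ) ^ 2 := by
  have h2 := pow_le_pow_left₀ (sin_pi_div_nonneg N) (sin_pi_div_le N) 2
  rw [div_pow] at h2
  rw [circleGap]
  calc _ ≤ 2 * (4 ^ 2 / (N : ℝ) ^ 2) := by gcongr
    _ = _ := by ring

/-- The cosine of a single coordinate is an eigenfunction with eigenvalue `circleGap N`. Only this
inequality is needed, as it lets the rate `circleGap` in the upper bound be replaced by
`spectralGap`. -/
lemma spectralGap_le (hd : 1 ≤ d) (hN : 3 ≤ N) : spectralGap d N ≤ circleGap N := by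
  have hN0 : (0 : ℝ) < N := Nat.cast_pos.2 (by omega)
  refine csInf_le ?_ ⟨?_, ?_⟩
  · exact ((Module.End.finite_hasEigenvalue _).subset fun μ hμ => hμ.2).bddBelow
  · exact (lt_of_lt_of_le (by positivity) (circleGap_ge (by omega : 2 ≤ N))).ne'
  · set i₀ : Fin d := ⟨0, hd⟩
    set ψ : Torus d N → ℝ := fun x => charRe (x i₀) with hψ
    refine Module.End.hasEigenvalue_of_hasEigenvector (x := ψ) ⟨?_, ?_⟩
    · rw [Module.End.mem_eigenspace_iff]
      funext x
      simp only [LinearMap.neg_apply, Pi.neg_apply, Pi.smul_apply, smul_eq_mul]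
      rw [rwGenerator_apply hN, laplacian, Finset.sum_eq_single i₀]
      · simp only [hψ, unitVec, Pi.add_apply, Pi.sub_apply, Pi.single_eq_same]
        rw [charRe_add_add_charRe_sub, ← charRe_one (by omega : 2 ≤ N)]
        ring
      · intro i _ hi
        simp only [hψ, unitVec, Pi.add_apply, Pi.sub_apply, Pi.single_eq_of_ne hi.symm, add_zero,
          sub_zero]
        ring
      · simp
    · intro h
      have := congrFun h 0
      simp [hψ, charRe_zero] at this

end Duality

/-! ### Gradient estimates -/

section Gradient

lemma diffScale_mono (N : ℕ) : Monotone (diffScale N) := fun _ _ h =>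
  max_le_max le_rfl (min_le_min le_rfl (Real.sqrt_le_sqrt h))

lemma diffScale_sq (N : ℕ) {t : ℝ} (ht : 0 ≤ t) :
    diffScale N t ^ 2 = max 1 (min ((N : ℝ) ^ 2) t) := by
  have hN : (0 : ℝ) ≤ N := Nat.cast_nonneg N
  have hmono : MonotoneOn (fun x : ℝ => x ^ 2) (Set.Ici 0) := fun a ha b _ hab =>
    pow_le_pow_left₀ ha hab 2
  have h1 := hmono.map_max (a := 1) (b := min (N : ℝ) (Real.sqrt t)) (zero_le_one' ℝ)
    (le_min hN (Real.sqrt_nonneg t))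
  have h2 := hmono.map_min (a := (N : ℝ)) (b := Real.sqrt t) hN (Real.sqrt_nonneg t)
  simp only [one_pow, Real.sq_sqrt ht] at h1 h2
  rw [diffScale, h1, h2]

/-- The squared scale is a truncation of t to [1, N²] and so shrinks at most linearly when time
shrinks. It is applied with ratios 1 - δ (short lags) and δ (long lags). -/
lemma mul_diffScale_sq_le (N : ℕ) {c s t : ℝ} (hc0 : 0 ≤ c) (hc1 : c ≤ 1) (hs : 0 ≤ s)
    (ht : 0 ≤ t) (h : c * t ≤ s) : c * diffScale N t ^ 2 ≤ diffScale N s ^ 2 := by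
  rw [diffScale_sq N hs, diffScale_sq N ht, mul_max_of_nonneg _ _ hc0, mul_min_of_nonneg _ _ hc0,
    mul_one]
  exact max_le_max hc1 (min_le_min (mul_le_of_le_one_left (by positivity) hc1) h)

lemma pow_mul_diffScale_pow_le (N : ℕ) {c s t : ℝ} (hc0 : 0 ≤ c) (hc1 : c ≤ 1) (hs : 0 ≤ s)
    (ht : 0 ≤ t) (h : c * t ≤ s) (n : ℕ) :
    c ^ n * diffScale N t ^ (2 * n) ≤ diffScale N s ^ (2 * n) := by
  rw [pow_mul, pow_mul, ← mul_pow]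
  exact pow_le_pow_left₀ (by positivity) (mul_diffScale_sq_le N hc0 hc1 hs ht h) n

lemma max_min_pow_le_diffScale_pow {N : ℕ} {t : ℝ} (ht : 0 ≤ t) (n : ℕ) :
    max (min ((N : ℝ) ^ (2 * n)) (t ^ n)) 1 ≤ diffScale N t ^ (2 * n) := by
  rw [pow_mul, pow_mul, diffScale_sq N ht]
  refine max_le ?_ (one_le_pow₀ (le_max_left _ _))
  rcases le_total ((N : ℝ) ^ 2) t with h | h
  · refine (min_le_left _ _).trans (pow_le_pow_left₀ (by positivity) ?_ n)
    rw [min_eq_left h]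
    exact le_max_right _ _
  · refine (min_le_right _ _).trans (pow_le_pow_left₀ ht ?_ n)
    rw [min_eq_right h]
    exact le_max_right _ _

/-- The tilt 2γ - ε cancels the squared decay up to exp(-ε r), the remainder that keeps the
late-time integrals finite uniformly in `T`. -/
lemma exp_mul_sq_le {C γ ε r M X : ℝ} (h : |X| ≤ C * Real.exp (-(γ * r)) / M) :
    Real.exp ((2 * γ - ε) * r) * X ^ 2 ≤ C ^ 2 * Real.exp (-(ε * r)) / M ^ 2 := by
  have h1 : X ^ 2 ≤ (C * Real.exp (-(γ * r)) / M) ^ 2 := by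
    rw [← sq_abs X]
    exact pow_le_pow_left₀ (abs_nonneg X) h 2
  refine (mul_le_mul_of_nonneg_left h1 (Real.exp_pos _).le).trans (le_of_eq ?_)
  have h2 : Real.exp (-(ε * r)) = Real.exp ((2 * γ - ε) * r) * Real.exp (-(γ * r)) ^ 2 := by
    rw [← Real.exp_nat_mul, ← Real.exp_add]
    congr 1
    push_cast
    ring
  rw [h2]
  ring

lemma exp_mul_le {C γ ε r M X : ℝ} (h : X ≤ C * Real.exp (-(γ * (2 * r))) / M) :
    Real.exp ((2 * γ - ε) * r) * X ≤ C * Real.exp (-(ε * r)) / M := by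
  refine (mul_le_mul_of_nonneg_left h (Real.exp_pos _).le).trans (le_of_eq ?_)
  have h2 : Real.exp (-(ε * r)) = Real.exp ((2 * γ - ε) * r) * Real.exp (-(γ * (2 * r))) := by
    rw [← Real.exp_add]
    ring_nf
  rw [h2]
  ring

lemma exp_neg_mul_inv_le_one {a r : ℝ} (ha : 0 ≤ a) (hr : 0 ≤ r) : Real.exp (-(a * r)) ≤ 1 :=
  Real.exp_le_one_iff.2 (neg_nonpos.2 (mul_nonneg ha hr))

variable {d N : ℕ} [NeZero N]

/-- The exponential rate at which second moments are weighted: twice the spectral gap, up to an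
error of order `N ^ (-(d + 2))`. -/
def tiltRate (d N : ℕ) : ℝ := 2 * circleGap N - 1 / (N : ℝ) ^ (d + 2)

lemma tiltRate_nonneg (hN : 2 ≤ N) : 0 ≤ tiltRate d N := by
  have h1 := circleGap_ge hN
  have hN1 : (1 : ℝ) ≤ N := by exact_mod_cast (by omega : 1 ≤ N)
  have h2 : 1 / (N : ℝ) ^ (d + 2) ≤ 1 / (N : ℝ) ^ 2 := by
    gcongr
    omega
  have h3 : 8 / (N : ℝ) ^ 2 = 8 * (1 / (N : ℝ) ^ 2) := by ring
  have h4 : 0 < 1 / (N : ℝ) ^ 2 := by positivity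
  rw [tiltRate]
  linarith

lemma tiltRate_le (d N : ℕ) : tiltRate d N ≤ 64 / (N : ℝ) ^ 2 := by
  have h1 := circleGap_le N
  have h2 : 0 ≤ 1 / (N : ℝ) ^ (d + 2) := by positivity
  have h3 : 64 / (N : ℝ) ^ 2 = 2 * (32 / (N : ℝ) ^ 2) := by ring
  rw [tiltRate]
  linarith

lemma grad_torusKernel_zero (hN : 2 ≤ N) (i : Fin d) :
    grad (torusKernel 0) ((0 : Torus d N), i) = -1 := by
  have : Fact (1 < N) := ⟨by omega⟩
  have h : (unitVec i : Torus d N) ≠ 0 := by simp [unitVec]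
  simp [grad, torusKernel_zero, h]

/-- The weighted mass of the renewal kernel. -/
lemma integral_kernel_le {C : ℝ} (hC : 0 ≤ C) (hd : 1 ≤ d) (hN : 4 ≤ N)
    (hCN : 1280 * C ≤ N)
    (hb : ∀ t : ℝ, 0 ≤ t → ∀ e : Torus d N × Fin d, |grad (torusKernel t) e|
      ≤ C * Real.exp (-(circleGap N * t)) / diffScale N t ^ (d + 1))
    {T : ℝ} (hT : 0 ≤ T) (e : Torus d N × Fin d) :
    ∫ r in 0..T, ∑ f, Real.exp (tiltRate d N * r) * (1 / 4 * grad (edgeFlow r e) f ^ 2)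
      ≤ 5 / 8 := by
  have hN0 : (0 : ℝ) < N := Nat.cast_pos.2 (by omega)
  set V : ℝ → ℝ := fun r => ∑ z, edgeFlow r e z ^ 2 with hV
  have hVd : ∀ r, HasDerivAt V (-∑ f, grad (edgeFlow r e) f ^ 2) r := fun r =>
    hasDerivAt_sum_sq fun x => hasDerivAt_edgeFlow r e x
  have hVc : Continuous V := continuous_iff_continuousAt.2 fun r => (hVd r).continuousAt
  have h := integral_exp_mul_le (θ := tiltRate d N) (T := T) hVd
    (continuous_finsetSum _ fun f _ => (continuous_grad_edgeFlow f e).pow 2)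
    (Finset.sum_nonneg fun z _ => sq_nonneg _)
  have hV0 : V 0 = 2 := by
    simp only [hV, sum_edgeFlow_sq, mul_zero, grad_torusKernel_zero (by omega : 2 ≤ N)]
    norm_num
  have hcm := continuous_diffScale N
  have hm0 : ∀ r, diffScale N r ^ (d + 1) ≠ 0 := fun r => (pow_pos (diffScale_pos N r) _).ne'
  have hVint : ∫ r in 0..T, Real.exp (tiltRate d N * r) * V r ≤ 2 * C * (5 * N) := by
    calc _ ≤ ∫ r in 0..T, 2 * C
          * (Real.exp (-(r / (N : ℝ) ^ (d + 2))) / diffScale N r ^ (d + 1)) := by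
          refine intervalIntegral.integral_mono_on hT
            (Continuous.intervalIntegrable (by fun_prop) _ _)
            (Continuous.intervalIntegrable (by fun_prop (disch := assumption)) _ _)
            fun r hr => ?_
          have h1 : V r ≤ 2 * C * Real.exp (-(circleGap N * (2 * r)))
              / diffScale N r ^ (d + 1) := by
            simp only [hV, sum_edgeFlow_sq]
            have h2 := hb (2 * r) (by linarith [hr.1]) (0, e.2)
            have h3 : diffScale N r ≤ diffScale N (2 * r) :=
              diffScale_mono N (by linarith [hr.1])
            have h4 := diffScale_pos N r
            have h5 : C * Real.exp (-(circleGap N * (2 * r))) / diffScale N (2 * r) ^ (d + 1)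
                ≤ C * Real.exp (-(circleGap N * (2 * r))) / diffScale N r ^ (d + 1) := by
              gcongr
            have h6 := (abs_le.1 (h2.trans h5)).1
            have h7 : 2 * C * Real.exp (-(circleGap N * (2 * r))) / diffScale N r ^ (d + 1)
              = 2 * (C * Real.exp (-(circleGap N * (2 * r))) / diffScale N r ^ (d + 1)) := by ring
            rw [h7]
            linarith
          refine (exp_mul_le (ε := 1 / (N : ℝ) ^ (d + 2)) h1).trans (le_of_eq ?_)
          rw [one_div_mul_eq_div]
          ring
      _ = 2 * C * ∫ r in 0..T, Real.exp (-(r / (N : ℝ) ^ (d + 2))) / diffScale N r ^ (d + 1) :=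
          intervalIntegral.integral_const_mul _ _
      _ ≤ _ := by
          gcongr
          exact integral_exp_div_diffScale_succ_le hd (by omega) hT
  have h2 : tiltRate d N * ∫ r in 0..T, Real.exp (tiltRate d N * r) * V r ≤ 1 / 2 := by
    calc _ ≤ tiltRate d N * (2 * C * (5 * N)) :=
          mul_le_mul_of_nonneg_left hVint (tiltRate_nonneg (by omega))
      _ ≤ 64 / (N : ℝ) ^ 2 * (2 * C * (5 * N)) := by
          gcongr
          exact tiltRate_le d N
      -- The largeness of `N` is used here: the cost of the tilt is O(N⁻²) * O(N), and 1280 C ≤ N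
      -- makes it at most 1/2.
      _ = 640 * C / N := by field_simp; ring
      _ ≤ _ := by rw [div_le_iff₀ hN0]; linarith
  have h3 : ∫ r in 0..T, ∑ f, Real.exp (tiltRate d N * r) * (1 / 4 * grad (edgeFlow r e) f ^ 2)
      = 1 / 4 * ∫ r in 0..T, Real.exp (tiltRate d N * r) * ∑ f, grad (edgeFlow r e) f ^ 2 := by
    rw [← intervalIntegral.integral_const_mul]
    refine intervalIntegral.integral_congr fun r _ => ?_
    simp only [Finset.mul_sum]
    exact Finset.sum_congr rfl fun f _ => by ring
  rw [h3]
  -- The bound is 1/4 * (2 + 1/2) = 5/8, where 2 is the initial energy.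
  linarith

/-- The weighted mass of the source term of the renewal equation. -/
lemma integral_source_le {C : ℝ} (hC : 0 ≤ C) (hN : 4 ≤ N)
    (hb : ∀ t : ℝ, 0 ≤ t → torusKernel t (0 : Torus d N) - 1 / (N : ℝ) ^ d
      ≤ C * Real.exp (-(circleGap N * t)) / diffScale N t ^ d) {T : ℝ} (hT : 0 ≤ T) :
    ∫ r in 0..T, ∑ f : Torus d N × Fin d,
      Real.exp (tiltRate d N * r) * grad (torusKernel r) f ^ 2 ≤ 1 + 256 * C := by
  have hN0 : (0 : ℝ) < N := Nat.cast_pos.2 (by omega)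
  -- The equilibrium energy N ^ (-d) is subtracted. This leaves the dissipation unchanged and makes
  -- `V` decay at twice the gap.
  set V : ℝ → ℝ := fun r => ∑ z : Torus d N, torusKernel r z ^ 2 - 1 / (N : ℝ) ^ d with hV
  have hVeq : ∀ r, V r = torusKernel (2 * r) (0 : Torus d N) - 1 / (N : ℝ) ^ d := fun r => by
    simp only [hV, sum_torusKernel_sq]
  have hVd : ∀ r, HasDerivAt V (-∑ f : Torus d N × Fin d, grad (torusKernel r) f ^ 2) r := fun r =>
    (hasDerivAt_sum_sq fun x => hasDerivAt_torusKernel r x).sub_const _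
  have hVc : Continuous V := continuous_iff_continuousAt.2 fun r => (hVd r).continuousAt
  have hVT : 0 ≤ V T := by
    rw [hVeq, sub_nonneg]
    exact inv_pow_le_torusKernel _
  have hkc : ∀ z : Torus d N, Continuous fun r => torusKernel r z := fun z =>
    continuous_iff_continuousAt.2 fun r => (hasDerivAt_torusKernel r z).continuousAt
  have h := integral_exp_mul_le (θ := tiltRate d N) (T := T) hVd
    (continuous_finsetSum _ fun f _ => ((hkc _).sub (hkc _)).pow 2) hVT
  have hV0 : V 0 ≤ 1 := by
    rw [hVeq, mul_zero, torusKernel_zero, if_pos rfl]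
    have : 0 ≤ 1 / (N : ℝ) ^ d := by positivity
    linarith
  have hcm := continuous_diffScale N
  have hm0 : ∀ r, diffScale N r ^ d ≠ 0 := fun r => (pow_pos (diffScale_pos N r) _).ne'
  have hVint : ∫ r in 0..T, Real.exp (tiltRate d N * r) * V r ≤ C * (4 * (N : ℝ) ^ 2) := by
    calc _ ≤ ∫ r in 0..T, C * (Real.exp (-(r / (N : ℝ) ^ (d + 2))) / diffScale N r ^ d) := by
          refine intervalIntegral.integral_mono_on hT
            (Continuous.intervalIntegrable (by fun_prop) _ _)
            (Continuous.intervalIntegrable (by fun_prop (disch := assumption)) _ _)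
            fun r hr => ?_
          have h1 : V r ≤ C * Real.exp (-(circleGap N * (2 * r))) / diffScale N r ^ d := by
            rw [hVeq]
            refine (hb (2 * r) (by linarith [hr.1])).trans ?_
            have h3 : diffScale N r ≤ diffScale N (2 * r) :=
              diffScale_mono N (by linarith [hr.1])
            have h4 := diffScale_pos N r
            gcongr
          refine (exp_mul_le (ε := 1 / (N : ℝ) ^ (d + 2)) h1).trans (le_of_eq ?_)
          rw [one_div_mul_eq_div]
          ring
      _ = C * ∫ r in 0..T, Real.exp (-(r / (N : ℝ) ^ (d + 2))) / diffScale N r ^ d :=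
          intervalIntegral.integral_const_mul _ _
      _ ≤ _ := by
          gcongr
          exact integral_exp_div_diffScale_le d (by omega) hT
  have h2 : tiltRate d N * ∫ r in 0..T, Real.exp (tiltRate d N * r) * V r ≤ 256 * C := by
    calc _ ≤ tiltRate d N * (C * (4 * (N : ℝ) ^ 2)) :=
          mul_le_mul_of_nonneg_left hVint (tiltRate_nonneg (by omega))
      _ ≤ 64 / (N : ℝ) ^ 2 * (C * (4 * (N : ℝ) ^ 2)) := by
          gcongr
          exact tiltRate_le d N
      _ = _ := by field_simp; ring
  simp only [← Finset.mul_sum]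
  linarith

variable (d) in
/-- Decay of the mean squared increments of the averaging process. -/
lemma exists_meanSqGrad_le (hd : 1 ≤ d) : ∃ C : ℝ, 0 < C ∧ ∃ N₀ : ℕ, ∀ (N : ℕ) [NeZero N],
    N₀ ≤ N → (∀ t : ℝ, 0 ≤ t → ∀ e : Torus d N × Fin d, 0 ≤ meanSqGrad t e) →
      ∀ t : ℝ, 0 ≤ t → ∀ e : Torus d N × Fin d,
        meanSqGrad t e ≤ C / diffScale N t ^ (2 * (d + 1)) * Real.exp (-(tiltRate d N * t)) := by
  obtain ⟨C, hC1, hb⟩ := exists_torusKernel_bounds d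
  have hC0 : 0 < C := by linarith
  -- By Bernoulli, (1 - δ) ^ (d + 1) ≥ 1 - (d + 1)δ = 5/6, which is the weight ratio 6/5 required by
  -- `renewal_bound`.
  set δ : ℝ := 1 / (6 * (d + 1)) with hδ
  have hd0 : (0 : ℝ) ≤ d := Nat.cast_nonneg d
  have hδ0 : 0 < δ := by positivity
  have hδ1 : δ ≤ 1 := by
    rw [hδ, div_le_one (by positivity)]
    linarith
  have hδd : 5 / 6 ≤ (1 - δ) ^ (d + 1) := by
    have h := one_add_mul_le_pow (a := -δ) (by linarith) (d + 1)
    rw [← sub_eq_add_neg 1 δ] at h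
    refine le_trans (le_of_eq ?_) h
    rw [hδ]
    push_cast
    field_simp
    ring
  refine ⟨4 * (C ^ 2 + C ^ 2 / δ ^ (d + 1) * (8 / 3 * (1 + 256 * C))), by positivity,
    max 4 ⌈1280 * C⌉₊, ?_⟩
  intro N _ hN hnonneg T hT f
  have hN4 : 4 ≤ N := (le_max_left _ _).trans hN
  have hCN : 1280 * C ≤ N := Nat.ceil_le.1 ((le_max_right _ _).trans hN)
  have hN0 : (0 : ℝ) < N := Nat.cast_pos.2 (by omega)
  have hε : (0 : ℝ) ≤ 1 / (N : ℝ) ^ (d + 2) := by positivity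
  have hkc : ∀ z : Torus d N, Continuous fun r => torusKernel r z := fun z =>
    continuous_iff_continuousAt.2 fun r => (hasDerivAt_torusKernel r z).continuousAt
  have hec : Continuous fun r : ℝ => Real.exp (tiltRate d N * r) := by fun_prop
  have hmain := renewal_bound
    (g := fun t (e : Torus d N × Fin d) => Real.exp (tiltRate d N * t) * meanSqGrad t e)
    (h := fun t (e : Torus d N × Fin d) =>
      Real.exp (tiltRate d N * t) * grad (torusKernel t) e ^ 2)
    (K := fun t e f => Real.exp (tiltRate d N * t) * (1 / 4 * grad (edgeFlow t f) e ^ 2))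
    (w := fun t => diffScale N t ^ (2 * (d + 1))) (δ := δ) (C₁ := C ^ 2)
    (C₂ := C ^ 2 / δ ^ (d + 1)) (C₃ := 1 + 256 * C)
    (fun e => hec.mul (continuous_meanSqGrad e))
    (fun e => hec.mul (((hkc _).sub (hkc _)).pow 2))
    (fun e f => hec.mul (continuous_const.mul ((continuous_grad_edgeFlow e f).pow 2)))
    (fun t ht e => mul_nonneg (Real.exp_pos _).le (hnonneg t ht e))
    (fun t _ e f => by positivity)
    ?_ ?_
    (fun T hT f => integral_kernel_le hC0.le hd hN4 hCN (fun t ht => (hb N hN4 t ht).2.1) hT f)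
    ((continuous_diffScale N).pow _) (fun t => pow_pos (diffScale_pos N t) _) hδ0.le hδ1
    (by positivity) ?_
    (fun T hT => integral_source_le hC0.le hN4 (fun t ht => (hb N hN4 t ht).1) hT)
    ?_ ?_ hT f
  · have hm := pow_pos (diffScale_pos N T) (2 * (d + 1))
    rw [Real.exp_neg, div_mul_eq_mul_div, le_div_iff₀ hm, ← div_eq_mul_inv,
      le_div_iff₀ (Real.exp_pos _)]
    linarith
  -- The tilt is multiplicative, exp(θt) = exp(θs) exp(θ(t - s)), so the tilted quantities satisfy
  -- the same renewal equation.
  · intro t _ f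
    rw [meanSqGrad_eq (by omega) t f, mul_add, ← intervalIntegral.integral_const_mul]
    refine le_of_eq (congrArg _ (intervalIntegral.integral_congr fun s _ => ?_))
    simp only [Finset.mul_sum]
    refine Finset.sum_congr rfl fun e _ => ?_
    have : Real.exp (tiltRate d N * t)
        = Real.exp (tiltRate d N * s) * Real.exp (tiltRate d N * (t - s)) := by
      rw [← Real.exp_add]
      ring_nf
    rw [this]
    ring
  · intro T hT e
    simp only [fun r f => grad_edgeFlow_comm r e f]
    exact integral_kernel_le hC0.le hd hN4 hCN (fun t ht => (hb N hN4 t ht).2.1) hT e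
  · intro s t hs hst hst'
    have h := pow_mul_diffScale_pow_le N (by linarith : 0 ≤ 1 - δ) (by linarith) hs
      (hs.trans hst') hst (d + 1)
    have h2 := mul_le_mul_of_nonneg_right hδd
      (pow_pos (diffScale_pos N t) (2 * (d + 1))).le
    linarith
  · intro t ht e
    have h := exp_mul_sq_le (ε := 1 / (N : ℝ) ^ (d + 2)) ((hb N hN4 t ht).2.1 e)
    have hm := pow_pos (diffScale_pos N t) (2 * (d + 1))
    rw [← pow_mul, mul_comm (d + 1) 2, le_div_iff₀ hm] at h
    have h1 := exp_neg_mul_inv_le_one hε ht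
    have h2 := mul_le_mul_of_nonneg_left h1 (sq_nonneg C)
    simp only [tiltRate]
    linarith
  -- The squared mixed difference decays like `diffScale` to the power -2(d + 2), two powers more
  -- than the weight requires; the surplus is dropped.
  · intro r t ht hr e f
    have hr0 : 0 ≤ r := (mul_nonneg hδ0.le ht).trans hr
    have h := exp_mul_sq_le (ε := 1 / (N : ℝ) ^ (d + 2)) ((hb N hN4 r hr0).2.2 e f)
    have hmr := one_le_diffScale N r
    have h1 := exp_neg_mul_inv_le_one hε hr0
    have h2 : C ^ 2 * Real.exp (-(1 / (N : ℝ) ^ (d + 2) * r)) / (diffScale N r ^ (d + 2)) ^ 2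
        ≤ C ^ 2 / diffScale N r ^ (2 * (d + 1)) := by
      rw [← pow_mul]
      have h3 : diffScale N r ^ (2 * (d + 1)) ≤ diffScale N r ^ ((d + 2) * 2) :=
        pow_le_pow_right₀ hmr (by omega)
      have h4 := pow_pos (diffScale_pos N r) (2 * (d + 1))
      gcongr
      exact mul_le_of_le_one_right (sq_nonneg C) h1
    have h5 := pow_mul_diffScale_pow_le N hδ0.le hδ1 hr0 ht hr (d + 1)
    have h6 : diffScale N t ^ (2 * (d + 1)) ≤ diffScale N r ^ (2 * (d + 1)) / δ ^ (d + 1) := by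
      rw [le_div_iff₀ (by positivity)]
      linarith
    have hX : 0 ≤ Real.exp ((2 * circleGap N - 1 / (N : ℝ) ^ (d + 2)) * r)
      * grad (edgeFlow r f) e ^ 2 := by positivity
    have h7 := h.trans h2
    have hm4 := pow_pos (diffScale_pos N r) (2 * (d + 1))
    calc _ ≤ diffScale N t ^ (2 * (d + 1))
          * (Real.exp ((2 * circleGap N - 1 / (N : ℝ) ^ (d + 2)) * r)
            * grad (edgeFlow r f) e ^ 2) := by
          refine mul_le_mul_of_nonneg_left ?_ (pow_pos (diffScale_pos N t) _).le
          simp only [tiltRate]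
          linarith
      _ ≤ diffScale N r ^ (2 * (d + 1)) / δ ^ (d + 1)
          * (C ^ 2 / diffScale N r ^ (2 * (d + 1))) := by
          gcongr
      _ = _ := by field_simp

end Gradient

end AvgTorus

end

/-! ### Conclusion -/

theorem mainTheorem5 (d : ℕ) (hd : 1 ≤ d) :
    ∃ B C : ℝ, 0 < B ∧ 0 < C ∧ ∃ N₀ : ℕ, ∀ (N : ℕ) [NeZero N], N₀ ≤ N →
      ∀ (Ω : Type*) [MeasurableSpace Ω] (P : Measure Ω) [IsProbabilityMeasure P]
        (η : ℝ≥0 → Ω → AvgTorus.Prob d N),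
        AvgTorus.IsAveragingProcess P (stdSimplex.vertex (S := ℝ) (0 : AvgTorus.Torus d N)) η →
        ∀ (t : ℝ≥0) (x y : AvgTorus.Torus d N), (AvgTorus.torusGraph d N).Adj x y →
          ∫ ω, (η t ω x - η t ω y) ^ 2 ∂P ≤
            C / max (min ((N : ℝ) ^ (2 * d + 2)) ((t : ℝ) ^ (d + 1))) 1 *
              Real.exp (-2 * (t : ℝ) / AvgTorus.relaxationTime d N
                + B * (t : ℝ) / (N : ℝ) ^ (d + 2)) := by
  obtain ⟨C, hC, N₀, hmain⟩ := AvgTorus.exists_meanSqGrad_le d hd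
  -- B = 1 is the coefficient of N ^ (-(d + 2)) given up in `tiltRate`.
  refine ⟨1, C, one_pos, hC, max 3 N₀, ?_⟩
  intro N _ hN Ω _ P _ η hη t x y hxy
  have hN3 : 3 ≤ N := (le_max_left _ _).trans hN
  -- Nonnegativity is read off from the given process: the semigroup value is an expectation of a
  -- square. Positivity of the operator exponential is thus not needed separately.
  have hnonneg : ∀ s : ℝ, 0 ≤ s → ∀ e : AvgTorus.Torus d N × Fin d,
      0 ≤ AvgTorus.meanSqGrad s e := by
    intro s hs e
    have h := hη.integral_sq_eq ⟨s, hs⟩ e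
    refine le_of_le_of_eq ?_ h
    exact integral_nonneg fun ω => sq_nonneg _
  have hedge : ∀ e : AvgTorus.Torus d N × Fin d, AvgTorus.meanSqGrad t e ≤
      C / max (min ((N : ℝ) ^ (2 * d + 2)) ((t : ℝ) ^ (d + 1))) 1 *
        Real.exp (-2 * (t : ℝ) / AvgTorus.relaxationTime d N
          + 1 * (t : ℝ) / (N : ℝ) ^ (d + 2)) := by
    intro e
    refine (hmain N ((le_max_right _ _).trans hN) hnonneg t t.2 e).trans ?_
    have h1 := AvgTorus.max_min_pow_le_diffScale_pow (N := N) t.2 (d + 1)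
    rw [show 2 * d + 2 = 2 * (d + 1) by ring]
    have h2 : (0 : ℝ) < max (min ((N : ℝ) ^ (2 * (d + 1))) ((t : ℝ) ^ (d + 1))) 1 :=
      lt_max_of_lt_right one_pos
    refine mul_le_mul (div_le_div_of_nonneg_left hC.le h2 h1) ?_ (Real.exp_pos _).le
      (by positivity)
    rw [Real.exp_le_exp, AvgTorus.relaxationTime, div_div_eq_mul_div, div_one,
      AvgTorus.tiltRate]
    have h3 := AvgTorus.spectralGap_le hd hN3
    have h4 := mul_le_mul_of_nonneg_left h3 t.2
    rw [NNReal.val_eq_coe] at h4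
    have h5 : 1 / (N : ℝ) ^ (d + 2) * t = 1 * t / (N : ℝ) ^ (d + 2) := by ring
    nlinarith
  obtain ⟨i, h | h⟩ := (AvgTorus.adj_iff hN3).1 hxy
  · have h1 := hη.integral_sq_eq t (x, i)
    simp only [← h] at h1
    refine le_trans (le_of_eq ?_) (hedge (x, i))
    rw [← h1]
    refine integral_congr_ae (Eventually.of_forall fun ω => ?_)
    simp only
    ring
  · have h1 := hη.integral_sq_eq t (y, i)
    have hx : y + AvgTorus.unitVec i = x := by rw [h, sub_add_cancel]
    simp only [hx] at h1
    exact (le_of_eq h1).trans (hedge (y, i))
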